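/- **Theorem.** Let $G=(V,A)$ be a finite directed acyclic graph whose vertices are items, and let $K$ be a set of $k$ agents. For $v\in V$ let $\mathrm{pred}[v]$ be the set of all $u\in V$ from which there is a directed path (possibly of length $0$) to $v$. An *allocation* $\pi$ assigns to the agents pairwise disjoint sets $\pi(i)\subseteq V$ ($i\in K$). Agent $i$ *dominates* $v$ if $\pi(i)\cap \mathrm{pred}[v]\ne\emptyset$, and the *dissatisfaction* $\delta_\pi(i)$ is the number of items that $i$ does not dominate. The problem CG Min-Sum Dissatisfaction asks, given $G$, $k$ and an integer $d$, whether there is an allocation $\pi$ with $\sum_{i\in K}\delta_\pi(i)\le d$; the optimization version asks for an allocation minimizing $\sum_{i\in K}\delta_\pi(i)$. Call an allocation *good* if for every $v\in V$ either every agent dominates $v$, or the items of $\mathrm{pred}[v]$ are all allocated, to pairwise distinct agents, and these agents form a cyclic interval of $K=\{0,\dots,k-1\}$. CG Min-Sum Dissatisfaction can be solved in linear time, for any number $k$ of agents, if $G$ is a polytree, i.e. a directed acyclic graph whose underlying undirected graph is a tree. More precisely, there are a random access machine program (with instructions for loading constants, addition, truncated subtraction, indirect load and store, jumps and jumps on zero,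 each of unit cost) and constants $C,c$ such that for all $n,k\ge 0$, all $d\in\mathbb Z$ and every polytree $G$ on $n$ vertices, given with $k$ and $d$ as a list of its arcs in arbitrary order, the program halts after at most $C(n+1)$ steps, all numbers that occur in registers and memory are at most $(n+k+|d|+2)^c$, and the output consists of the correct answer to the decision problem together with the labels (agent or "unallocated") of all items in an allocation that is good and minimizes the total dissatisfaction. The same holds for polyforests, i.e. directed acyclic graphs whose underlying undirected graph is a forest. -/

import Mathlib

namespace MinSumDissat

/-! ### Directed graphs -/

section Graphs

variable {V : Type*}

/-- No directed cycle: no vertex has a closed walk of positive length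
(in particular there are no loops and no pairs of opposite arcs). -/
def IsDAG (G : Digraph V) : Prop := ∀ v, ¬ Relation.TransGen G.Adj v v

/-- A polytree: a directed acyclic graph whose underlying undirected graph is a tree. -/
def IsPolytree (G : Digraph V) : Prop := IsDAG G ∧ G.toSimpleGraphInclusive.IsTree

/-- A polyforest: a directed acyclic graph whose underlying undirected graph is a forest. -/
def IsPolyforest (G : Digraph V) : Prop := IsDAG G ∧ G.toSimpleGraphInclusive.IsAcyclic

/-- The closed predecessor set `pred[v]`: all `u` with a directed path (possibly of length zero)
from `u` to `v`. -/
def closedPred (G : Digraph V) (v : V) : Set V := {u | Relation.ReflTransGen G.Adj u v}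

end Graphs

/-! ### Allocations and dissatisfaction -/

section Allocations

variable {V : Type*} {k : ℕ}

/-- An allocation of items to `k` agents: the agents get pairwise disjoint sets of items
(not every item has to be allocated). -/
structure Allocation (k : ℕ) (V : Type*) where
  items : Fin k → Set V
  disjoint : ∀ i j, i ≠ j → Disjoint (items i) (items j)

open Classical in
/-- The labeling of items by agents; `none` is the label of the unallocated items. -/
noncomputable def Allocation.label (π : Allocation k V) (v : V) : Option (Fin k) :=
  if h : ∃ i, v ∈ π.items i then some h.choose else none

theorem Allocation.label_eq_some_iff (π : Allocation k V) (v : V) (i : Fin k) :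
    π.label v = some i ↔ v ∈ π.items i := by
  unfold Allocation.label
  split_ifs with h
  · constructor
    · intro he
      rw [← Option.some.inj he]
      exact h.choose_spec
    · intro hi
      by_contra hne
      have hne' : h.choose ≠ i := fun e => hne (by rw [e])
      exact Set.disjoint_left.mp (π.disjoint _ _ hne') h.choose_spec hi
  · constructor
    · intro he
      cases he
    · intro hi
      exact (h ⟨i, hi⟩).elim

/-- Agent `i` dominates item `v`: some item of `π(i)` lies in `pred[v]`. -/
def Dominates (G : Digraph V) (π : Allocation k V) (i : Fin k) (v : V) : Prop :=
  ∃ u ∈ closedPred G v, u ∈ π.items i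

/-- The dissatisfaction of agent `i`: the number of items not dominated by an item of `π(i)`. -/
noncomputable def dissatisfaction (G : Digraph V) (π : Allocation k V) (i : Fin k) : ℕ :=
  Set.ncard {v | ¬ Dominates G π i v}

/-- The total dissatisfaction of all agents. -/
noncomputable def totalDissatisfaction (G : Digraph V) (π : Allocation k V) : ℕ :=
  ∑ i, dissatisfaction G π i

/-- `π` minimizes the total dissatisfaction among all allocations. -/
def IsOptimal (G : Digraph V) (π : Allocation k V) : Prop :=
  ∀ π' : Allocation k V, totalDissatisfaction G π ≤ totalDissatisfaction G π'

/-- The cyclic interval `[a, b]_k` of agents `0, …, k - 1`. -/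
def cyclicInterval (k : ℕ) (a b : ℤ) : Set (Fin k) :=
  {i | if a % k ≤ b % k then a % k ≤ (i : ℤ) ∧ (i : ℤ) ≤ b % k
       else a % k ≤ (i : ℤ) ∨ (i : ℤ) ≤ b % k}

/-- Every vertex `v` is dominated by all agents, or else the items in `pred[v]` are allocated to
pairwise distinct agents and these agents form a cyclic interval. -/
def IsGood (G : Digraph V) (π : Allocation k V) : Prop :=
  ∀ v, (∀ i, Dominates G π i v) ∨
    ((∀ u ∈ closedPred G v, π.label u ≠ none) ∧
      Set.InjOn π.label (closedPred G v) ∧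
      ∃ a b : ℤ, {i | Dominates G π i v} = cyclicInterval k a b)

end Allocations

/-! ### Random access machines

A machine has registers and a memory, both indexed by `ℕ` and holding natural numbers; a program
is a fixed finite list of instructions (so it names finitely many registers), and every
instruction costs one step. -/

inductive Instr where
  /-- `r := c` for a constant `c` -/
  | const (r c : ℕ)
  /-- `r := a + b` -/
  | add (r a b : ℕ)
  /-- `r := a - b`, truncated at zero -/
  | sub (r a b : ℕ)
  /-- `r := memory[a]` -/
  | load (r a : ℕ)
  /-- `memory[a] := b` -/
  | store (a b : ℕ)
  /-- go to instruction `l` if register `a` is zero -/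
  | jumpZero (a l : ℕ)
  /-- go to instruction `l` -/
  | jump (l : ℕ)

abbrev Program := List Instr

@[ext]
structure State where
  pc : ℕ
  reg : ℕ → ℕ
  mem : ℕ → ℕ

def Instr.exec (s : State) : Instr → State
  | .const r c => ⟨s.pc + 1, Function.update s.reg r c, s.mem⟩
  | .add r a b => ⟨s.pc + 1, Function.update s.reg r (s.reg a + s.reg b), s.mem⟩
  | .sub r a b => ⟨s.pc + 1, Function.update s.reg r (s.reg a - s.reg b), s.mem⟩
  | .load r a => ⟨s.pc + 1, Function.update s.reg r (s.mem (s.reg a)), s.mem⟩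
  | .store a b => ⟨s.pc + 1, s.reg, Function.update s.mem (s.reg a) (s.reg b)⟩
  | .jumpZero a l => ⟨if s.reg a = 0 then l else s.pc + 1, s.reg, s.mem⟩
  | .jump l => ⟨l, s.reg, s.mem⟩

/-- The machine has halted when the program counter points past the program. -/
def Halted (P : Program) (s : State) : Prop := P.length ≤ s.pc

/-- One step; a halted machine does not move any more. -/
def step (P : Program) (s : State) : State :=
  match P[s.pc]? with
  | some ins => ins.exec s
  | none => s

/-- The state after `t` steps. -/
def run (P : Program) (s : State) (t : ℕ) : State := (step P)^[t] s

/-- All registers and memory cells hold numbers of size at most `W`. -/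
def WordsBounded (W : ℕ) (s : State) : Prop := (∀ r, s.reg r ≤ W) ∧ ∀ a, s.mem a ≤ W

/-- The start of the program with the list `ws` at the memory cells `0, 1, 2, …`; all
other memory cells and all registers are zero. -/
def initState (ws : List ℕ) : State := ⟨0, fun _ => 0, fun a => ws.getD a 0⟩

/-! ### The problem as a computational problem -/

/-- `arcs` lists every arc of `G` exactly once, in an arbitrary order. -/
def IsArcList {n : ℕ} (G : Digraph (Fin n)) (arcs : List (Fin n × Fin n)) : Prop :=
  arcs.Nodup ∧ ∀ u v, (u, v) ∈ arcs ↔ G.Adj u v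

/-- The input: `n`, `k`, the sign of `d` (`1` if `d < 0`, else `0`), `|d|`, the number of arcs,
and then tail and head of each arc. -/
def inputWords {n : ℕ} (k : ℕ) (d : ℤ) (arcs : List (Fin n × Fin n)) : List ℕ :=
  [n, k, if d < 0 then 1 else 0, d.natAbs, arcs.length] ++
    arcs.flatMap (fun e => [(e.1 : ℕ), (e.2 : ℕ)])

/-- The agents are written as `1, …, k` and the label of an unallocated item as `0`. -/
def labelCode {k : ℕ} : Option (Fin k) → ℕ
  | none => 0
  | some i => (i : ℕ) + 1

open Classical in
/-- The output for the instance `(G, k, d)`: cell `0` holds the answer (`1` for yes, `0` for no) to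
the question whether some allocation has total dissatisfaction at most `d`, and cell `v + 1`
holds the label of item `v` in a good and optimal allocation. -/
def CorrectOutput {n : ℕ} (G : Digraph (Fin n)) (k : ℕ) (d : ℤ) (mem : ℕ → ℕ) : Prop :=
  (mem 0 = if ∃ π : Allocation k (Fin n), (totalDissatisfaction G π : ℤ) ≤ d then 1 else 0) ∧
  ∃ π : Allocation k (Fin n), IsOptimal G π ∧ IsGood G π ∧
    ∀ v : Fin n, mem ((v : ℕ) + 1) = labelCode (π.label v)

/-- The problem (both the decision problem and the search for a good, optimal allocation) can be
solved in linear time on the graphs in the class `𝒢`: one program, on every input, for every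
number `k` of agents, halts after at most `C * (n + 1)` steps with a correct output, and works with
words of `O(log (n + k + |d|))` bits. -/
def SolvableInLinearTime (𝒢 : ∀ n : ℕ, Digraph (Fin n) → Prop) : Prop :=
  ∃ (P : Program) (C c : ℕ), ∀ (n k : ℕ) (d : ℤ) (G : Digraph (Fin n))
    (arcs : List (Fin n × Fin n)), 𝒢 n G → IsArcList G arcs →
    ∃ T ≤ C * (n + 1),
      Halted P (run P (initState (inputWords k d arcs)) T) ∧
      (∀ t ≤ T, WordsBounded ((n + k + d.natAbs + 2) ^ c)
        (run P (initState (inputWords k d arcs)) t)) ∧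
      CorrectOutput G k d (run P (initState (inputWords k d arcs)) T).mem

end MinSumDissat

namespace MinSumDissat

/-! At most min(k, |pred[v]|) agents can dominate an item v, because each of them labels an item of
pred[v] (`ncard_dominates_le`). By double counting, the total dissatisfaction is the sum over v of k
minus the number of agents dominating v. A good allocation attains the bound at every vertex, hence
is optimal (`IsGood.isOptimal`).

In a polyforest the sets pred[u], for the in-neighbors u of v, are pairwise disjoint: directed paths
from a common predecessor would close a cycle through v. So it suffices to find places s(v) modulo k
such that v takes place s(v) and the blocks of its in-neighbors follow end to end, in some order.
`IsLayout` states this locally, with block lengths q capped at k; `IsLayout.image_closedPred`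
deduces that the labels of pred[v] fill the block of length q(v) = min(k, |pred[v]|) starting at
s(v).

Each arc contributes one equation between the places of its ends, and without cycles these equations
are always solvable. Leaves are removed one at a time, while acc(v) counts the places already
reserved behind s(v). If the leaf x has an arc to its neighbor w, the block of x goes to the first
free place of w, and acc(w) grows by acc(x). If the arc comes from w, the block of w goes to the
first free place of x. In both cases s(x) - s(w) is known when x is removed, and reinserting the
leaves in reverse order yields a layout (`IsLayout.extend_tail`, `IsLayout.extend_head`).

For linear time no adjacency lists are needed. Each vertex keeps its degree, its out-degree and the
sum of the addresses of its neighbors; at a leaf, this sum is the address of the only neighbor.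
Removing a leaf can create a new leaf only at its neighbor, so following neighbors during one scan
of the vertices finds all leaves. The program is written in a small structured language with a
compiler and a calculus for running time and word size. -/

/-! ### A structured language for random access machines -/

/-- The contents of registers and memory. -/
structure Store where
  reg : ℕ → ℕ
  mem : ℕ → ℕ

/-- All registers and memory cells hold numbers of size at most `W`. -/
def Store.Bounded (W : ℕ) (s : Store) : Prop := (∀ r, s.reg r ≤ W) ∧ ∀ a, s.mem a ≤ W

/-- The machine state with the given store and program counter. -/
def Store.toState (s : Store) (pc : ℕ) : State := ⟨pc, s.reg, s.mem⟩

def Store.setReg (s : Store) (r x : ℕ) : Store := ⟨Function.update s.reg r x, s.mem⟩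

def Store.setMem (s : Store) (a x : ℕ) : Store := ⟨s.reg, Function.update s.mem a x⟩

/-- Structured commands. -/
inductive Cmd where
  | skip
  | const (r c : ℕ)
  | add (r a b : ℕ)
  | sub (r a b : ℕ)
  | load (r a : ℕ)
  | store (a b : ℕ)
  | seq (c₁ c₂ : Cmd)
  /-- execute `c₁` if register `a` is zero, else `c₂` -/
  | ite (a : ℕ) (c₁ c₂ : Cmd)
  /-- repeat `c` as long as register `a` is nonzero -/
  | loop (a : ℕ) (c : Cmd)

namespace Cmd

/-- Sequential composition of a list of commands. -/
def block : List Cmd → Cmd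
  | [] => skip
  | c :: l => seq c (block l)

/-- The number of machine instructions of the compiled command. -/
def size : Cmd → ℕ
  | skip => 0
  | seq c₁ c₂ => c₁.size + c₂.size
  | ite _ c₁ c₂ => c₁.size + c₂.size + 2
  | loop _ c => c.size + 2
  | _ => 1

/-- The machine code of a command that starts at the address `o`. -/
def compile : Cmd → ℕ → Program
  | skip, _ => []
  | const r c, _ => [.const r c]
  | add r a b, _ => [.add r a b]
  | sub r a b, _ => [.sub r a b]
  | load r a, _ => [.load r a]
  | store a b, _ => [.store a b]
  | seq c₁ c₂, o => c₁.compile o ++ c₂.compile (o + c₁.size)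
  | ite a c₁ c₂, o => [.jumpZero a (o + 1 + c₂.size + 1)] ++ (c₂.compile (o + 1) ++
      ([.jump (o + 1 + c₂.size + 1 + c₁.size)] ++ c₁.compile (o + 1 + c₂.size + 1)))
  | loop a c, o => [.jumpZero a (o + 1 + c.size + 1)] ++ (c.compile (o + 1) ++ [.jump o])

theorem length_compile (c : Cmd) : ∀ o, (c.compile o).length = c.size := by
  induction c with
  | seq c₁ c₂ h₁ h₂ => intro o; simp [compile, size, h₁, h₂]
  | ite a c₁ c₂ h₁ h₂ => intro o; simp [compile, size, h₁, h₂]; omega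
  | loop a c h => intro o; simp [compile, size, h]
  | _ => intro o; rfl

end Cmd

/-- The program `P` contains the code `l` at the address `o`. -/
def CodeAt (P : Program) (o : ℕ) (l : Program) : Prop :=
  ∃ A B, P = A ++ l ++ B ∧ A.length = o

theorem CodeAt.left {P : Program} {o : ℕ} {l₁ l₂ : Program} (h : CodeAt P o (l₁ ++ l₂)) :
    CodeAt P o l₁ := by
  obtain ⟨A, B, rfl, h⟩ := h
  exact ⟨A, l₂ ++ B, by simp, h⟩

theorem CodeAt.right {P : Program} {o m : ℕ} {l₁ l₂ : Program} (h : CodeAt P o (l₁ ++ l₂))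
    (hm : l₁.length = m) : CodeAt P (o + m) l₂ := by
  obtain ⟨A, B, rfl, h⟩ := h
  exact ⟨A ++ l₁, B, by simp, by simp [h, hm]⟩

theorem CodeAt.getElem? {P : Program} {o : ℕ} {i : Instr} (h : CodeAt P o [i]) :
    P[o]? = some i := by
  obtain ⟨A, B, rfl, rfl⟩ := h
  simp

/-- The program `P` runs in `t` steps from `s` to `s'`, and all words stay below `W`. -/
def Runs (P : Program) (W : ℕ) (s s' : State) (t : ℕ) : Prop :=
  run P s t = s' ∧ ∀ i ≤ t, WordsBounded W (run P s i)

theorem Runs.trans {P : Program} {W : ℕ} {s s' s'' : State} {t t' : ℕ}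
    (h : Runs P W s s' t) (h' : Runs P W s' s'' t') : Runs P W s s'' (t + t') := by
  have key : ∀ i, run P s (t + i) = run P s' i := by
    intro i
    rw [← h.1, run, run, run, Nat.add_comm, Function.iterate_add_apply]
  refine ⟨by rw [key, h'.1], fun i hi => ?_⟩
  rcases Nat.lt_or_ge i t with h1 | h1
  · exact h.2 i h1.le
  · obtain ⟨j, rfl⟩ := Nat.exists_eq_add_of_le h1
    rw [key]
    exact h'.2 j (by omega)

theorem Runs.refl {P : Program} {W : ℕ} {s : State} (h : WordsBounded W s) : Runs P W s s 0 :=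
  ⟨rfl, fun i hi => by rw [Nat.le_zero.mp hi]; exact h⟩

theorem Runs.single {P : Program} {W : ℕ} {s s' : State} {ins : Instr}
    (h : WordsBounded W s) (hP : P[s.pc]? = some ins) (hs : ins.exec s = s')
    (h' : WordsBounded W s') : Runs P W s s' 1 := by
  have key : run P s 1 = s' := by simp [run, step, hP, hs]
  refine ⟨key, fun i hi => ?_⟩
  interval_cases i
  · exact h
  · rw [key]; exact h'

/-! ### Rules for total correctness with running time and word size -/

namespace Cmd

/-- The command `c`, placed anywhere in a program, leads from `s` to `s'` in `t` steps, and all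
words stay below `W`. -/
def Exec (W : ℕ) (c : Cmd) (s s' : Store) (t : ℕ) : Prop :=
  ∀ P o, CodeAt P o (c.compile o) → Runs P W (s.toState o) (s'.toState (o + c.size)) t

/-- From `s` the command `c` reaches in at most `T` steps a store with the property `Q`, and all
words stay below `W`. -/
def Reaches (W : ℕ) (c : Cmd) (T : ℕ) (s : Store) (Q : Store → Prop) : Prop :=
  ∃ s' t, t ≤ T ∧ s'.Bounded W ∧ Exec W c s s' t ∧ Q s'

variable {W : ℕ}

theorem Reaches.mono {c : Cmd} {T T' : ℕ} {s : Store} {Q Q' : Store → Prop}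
    (h : Reaches W c T s Q) (hT : T ≤ T') (hQ : ∀ s', Q s' → Q' s') : Reaches W c T' s Q' := by
  obtain ⟨s', t, ht, hb, he, hq⟩ := h
  exact ⟨s', t, ht.trans hT, hb, he, hQ s' hq⟩

theorem Reaches.seq {c₁ c₂ : Cmd} {T₁ T₂ : ℕ} {s : Store} {Q R : Store → Prop}
    (h : Reaches W c₁ T₁ s Q) (h' : ∀ s', s'.Bounded W → Q s' → Reaches W c₂ T₂ s' R) :
    Reaches W (c₁.seq c₂) (T₁ + T₂) s R := by
  obtain ⟨s', t, ht, hb, he, hq⟩ := h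
  obtain ⟨s'', t', ht', hb', he', hr⟩ := h' s' hb hq
  refine ⟨s'', t + t', by omega, hb', fun P o hP => ?_, hr⟩
  have h1 := he P o hP.left
  have h2 := he' P _ (hP.right (length_compile _ _))
  rw [size, ← Nat.add_assoc]
  exact h1.trans h2

theorem Reaches.skip {s : Store} {Q : Store → Prop} (hs : s.Bounded W) (h : Q s) :
    Reaches W skip 0 s Q :=
  ⟨s, 0, le_rfl, hs, fun _ _ _ => Runs.refl hs, h⟩

/-- The two extra steps are the test and, after the branch for nonzero, which comes first in the
code, the jump over the other branch. -/
theorem Reaches.ite {a : ℕ} {c₁ c₂ : Cmd} {T₁ T₂ : ℕ} {s : Store} {Q : Store → Prop}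
    (hs : s.Bounded W) (h₁ : s.reg a = 0 → Reaches W c₁ T₁ s Q)
    (h₂ : s.reg a ≠ 0 → Reaches W c₂ T₂ s Q) :
    Reaches W (ite a c₁ c₂) (max T₁ T₂ + 2) s Q := by
  by_cases ha : s.reg a = 0
  · obtain ⟨s', t, ht, hb, he, hq⟩ := h₁ ha
    refine ⟨s', 1 + t, by omega, hb, fun P o hP => ?_, hq⟩
    have e₁ := hP.left.getElem?
    have e₂ := ((hP.right (m := 1) rfl).right (length_compile _ _)).right (m := 1) rfl
    refine Runs.trans (s' := s.toState (o + 1 + c₂.size + 1))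
      (Runs.single hs e₁ (by simp [Instr.exec, Store.toState, ha]) hs) ?_
    have h3 := he P _ e₂
    have e3 : o + (Cmd.ite a c₁ c₂).size = o + 1 + c₂.size + 1 + c₁.size := by
      rw [size]; omega
    rw [e3]
    exact h3
  · obtain ⟨s', t, ht, hb, he, hq⟩ := h₂ ha
    refine ⟨s', 1 + t + 1, by omega, hb, fun P o hP => ?_, hq⟩
    have e₁ := hP.left.getElem?
    have e₂ := (hP.right (m := 1) rfl).left
    have e₃ := ((hP.right (m := 1) rfl).right (length_compile _ _)).left.getElem?
    refine Runs.trans (Runs.trans (s' := s.toState (o + 1))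
      (Runs.single hs e₁ (by simp [Instr.exec, Store.toState, ha]) hs) (he P _ e₂)) ?_
    refine Runs.single hb e₃ ?_ hb
    have e3 : o + (Cmd.ite a c₁ c₂).size = o + 1 + c₂.size + 1 + c₁.size := by
      rw [size]; omega
    rw [e3]
    rfl

/-- The index of the invariant is a variant that drops in every round, so it bounds the number of
rounds. A round pays for the test and the jump back; the final 1 is the test that fails. -/
theorem Reaches.loop {a : ℕ} {c : Cmd} {T : ℕ} (Inv : ℕ → Store → Prop)
    (h : ∀ i s, s.Bounded W → Inv i s → s.reg a ≠ 0 →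
      Reaches W c T s fun s' => ∃ j < i, Inv j s') (i : ℕ) :
    ∀ s, s.Bounded W → Inv i s →
      Reaches W (loop a c) ((T + 2) * i + 1) s fun s' => s'.reg a = 0 ∧ ∃ j, Inv j s' := by
  induction i using Nat.strong_induction_on with
  | _ i ih =>
    intro s hs hi
    by_cases ha : s.reg a = 0
    · refine ⟨s, 1, by omega, hs, fun P o hP => ?_, ha, i, hi⟩
      have e₁ := hP.left.getElem?
      exact Runs.single hs e₁ (by simp [Instr.exec, Store.toState, ha, size]; omega) hs
    · obtain ⟨s', t, ht, hb, he, j, hj, hq⟩ := h i s hs hi ha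
      obtain ⟨s'', t', ht', hb', he', hq'⟩ := ih j hj s' hb hq
      refine ⟨s'', 1 + t + 1 + t', ?_, hb', fun P o hP => ?_, hq'⟩
      · have := Nat.mul_le_mul_left (T + 2) (Nat.succ_le_of_lt hj)
        rw [Nat.mul_succ] at this
        omega
      · have e₁ := hP.left.getElem?
        have e₂ := (hP.right (m := 1) rfl).left
        have e₃ := ((hP.right (m := 1) rfl).right (length_compile _ _)).getElem?
        refine Runs.trans (Runs.trans (Runs.trans (s' := s.toState (o + 1))
          (Runs.single hs e₁ (by simp [Instr.exec, Store.toState, ha]) hs) (he P _ e₂)) ?_)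
          (he' P o hP)
        exact Runs.single hb e₃ rfl hb

/-- The weakest precondition of a command without loops. -/
def wp (W : ℕ) : Cmd → (Store → Prop) → Store → Prop
  | skip, Q, s => Q s
  | const r c, Q, s => c ≤ W ∧ Q (s.setReg r c)
  | add r a b, Q, s => s.reg a + s.reg b ≤ W ∧ Q (s.setReg r (s.reg a + s.reg b))
  | sub r a b, Q, s => Q (s.setReg r (s.reg a - s.reg b))
  | load r a, Q, s => Q (s.setReg r (s.mem (s.reg a)))
  | store a b, Q, s => Q (s.setMem (s.reg a) (s.reg b))
  | seq c₁ c₂, Q, s => wp W c₁ (wp W c₂ Q) s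
  | ite a c₁ c₂, Q, s => (s.reg a = 0 → wp W c₁ Q s) ∧ (s.reg a ≠ 0 → wp W c₂ Q s)
  | loop _ _, _, _ => False

theorem wp_mono {c : Cmd} : ∀ {Q Q' : Store → Prop} {s : Store}, wp W c Q s →
    (∀ s', Q s' → Q' s') → wp W c Q' s := by
  induction c with
  | skip => exact fun h hQ => hQ _ h
  | const r c => exact fun h hQ => ⟨h.1, hQ _ h.2⟩
  | add r a b => exact fun h hQ => ⟨h.1, hQ _ h.2⟩
  | sub r a b => exact fun h hQ => hQ _ h
  | load r a => exact fun h hQ => hQ _ h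
  | store a b => exact fun h hQ => hQ _ h
  | seq c₁ c₂ h₁ h₂ => exact fun h hQ => h₁ h fun s' h' => h₂ h' hQ
  | ite a c₁ c₂ h₁ h₂ => exact fun h hQ => ⟨fun ha => h₁ (h.1 ha) hQ, fun ha => h₂ (h.2 ha) hQ⟩
  | loop a c _ => exact fun h _ => h.elim

/-- The running time of a command without loops. -/
def cost : Cmd → ℕ
  | skip => 0
  | seq c₁ c₂ => c₁.cost + c₂.cost
  | ite _ c₁ c₂ => max c₁.cost c₂.cost + 2
  | _ => 1

theorem Store.Bounded.setReg {s : Store} (hs : s.Bounded W) (r : ℕ) {x : ℕ} (hx : x ≤ W) :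
    (s.setReg r x).Bounded W := by
  refine ⟨fun r' => ?_, hs.2⟩
  simp only [Store.setReg, Function.update_apply]
  split_ifs
  · exact hx
  · exact hs.1 r'

theorem Store.Bounded.setMem {s : Store} (hs : s.Bounded W) (a : ℕ) {x : ℕ} (hx : x ≤ W) :
    (s.setMem a x).Bounded W := by
  refine ⟨hs.1, fun r' => ?_⟩
  simp only [Store.setMem, Function.update_apply]
  split_ifs
  · exact hx
  · exact hs.2 r'

/-- Only constants and sums can exceed the word size: truncated subtraction does not increase its
first argument, and loads and stores copy words. Hence `wp` demands a bound only in those two cases.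
-/
theorem Reaches.of_wp (c : Cmd) : ∀ {Q : Store → Prop} {s : Store}, s.Bounded W → wp W c Q s →
    Reaches W c c.cost s Q := by
  induction c with
  | skip => exact fun hs h => Reaches.skip hs h
  | const r c =>
    intro Q s hs h
    have hb := Store.Bounded.setReg hs r h.1
    exact ⟨_, 1, le_rfl, hb, fun P o hP => Runs.single hs hP.getElem? rfl hb, h.2⟩
  | add r a b =>
    intro Q s hs h
    have hb := Store.Bounded.setReg hs r h.1
    exact ⟨_, 1, le_rfl, hb, fun P o hP => Runs.single hs hP.getElem? rfl hb, h.2⟩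
  | sub r a b =>
    intro Q s hs h
    have hb := Store.Bounded.setReg hs r ((Nat.sub_le (s.reg a) (s.reg b)).trans (hs.1 a))
    exact ⟨_, 1, le_rfl, hb, fun P o hP => Runs.single hs hP.getElem? rfl hb, h⟩
  | load r a =>
    intro Q s hs h
    have hb := Store.Bounded.setReg hs r (hs.2 (s.reg a))
    exact ⟨_, 1, le_rfl, hb, fun P o hP => Runs.single hs hP.getElem? rfl hb, h⟩
  | store a b =>
    intro Q s hs h
    have hb := Store.Bounded.setMem hs (s.reg a) (hs.1 b)
    exact ⟨_, 1, le_rfl, hb, fun P o hP => Runs.single hs hP.getElem? rfl hb, h⟩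
  | seq c₁ c₂ h₁ h₂ => exact fun hs h => (h₁ hs h).seq fun s' hs' h' => h₂ hs' h'
  | ite a c₁ c₂ h₁ h₂ =>
    exact fun hs h => Reaches.ite hs (fun ha => h₁ hs (h.1 ha)) (fun ha => h₂ hs (h.2 ha))
  | loop a c _ => exact fun _ h => h.elim

end Cmd

/-! ### Directed paths in polyforests -/

section Forest

variable {V : Type*} {G : Digraph V}

theorem IsDAG.ne (h : IsDAG G) {u v : V} (huv : G.Adj u v) : u ≠ v := by
  rintro rfl
  exact h u (.single huv)

theorem IsDAG.not_reflTransGen (h : IsDAG G) {u v : V} (huv : G.Adj u v) :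
    ¬ Relation.ReflTransGen G.Adj v u :=
  fun hvu => h u (Relation.TransGen.head' huv hvu)

theorem IsDAG.adj_inclusive (h : IsDAG G) {u v : V} (huv : G.Adj u v) :
    G.toSimpleGraphInclusive.Adj u v :=
  ⟨h.ne huv, Or.inl huv⟩

/-- A directed path to a vertex that cannot be reached from `v` avoids all edges at `v`. -/
theorem IsDAG.reachable_deleteEdges (h : IsDAG G) {v w x y : V}
    (hxy : Relation.ReflTransGen G.Adj x y) (hvy : ¬ Relation.ReflTransGen G.Adj v y) :
    (G.toSimpleGraphInclusive.deleteEdges {s(w, v)}).Reachable x y := by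
  induction hxy using Relation.ReflTransGen.head_induction_on with
  | refl => exact .refl _
  | @head a b hab hby ih =>
    refine SimpleGraph.Reachable.trans (SimpleGraph.Adj.reachable ?_) ih
    rw [SimpleGraph.deleteEdges_adj]
    refine ⟨h.adj_inclusive hab, fun he => ?_⟩
    simp only [Set.mem_singleton_iff, Sym2.eq_iff] at he
    rcases he with ⟨_, rfl⟩ | ⟨rfl, _⟩
    · exact hvy hby
    · exact hvy (.head hab hby)

/-- In a forest the edge between `u₁` and `v` is a bridge. A common predecessor `x` would give a
detour from `u₁` back to `x`, on to `u₂` and then to `v`. The directed paths avoid `v`, because by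
acyclicity `v` reaches neither `u₁` nor `u₂`. -/
theorem IsPolyforest.disjoint_closedPred (h : IsPolyforest G) {u₁ u₂ v : V} (h₁ : G.Adj u₁ v)
    (h₂ : G.Adj u₂ v) (hne : u₁ ≠ u₂) : Disjoint (closedPred G u₁) (closedPred G u₂) := by
  rw [Set.disjoint_left]
  intro x hx₁ hx₂
  have hb := (SimpleGraph.isAcyclic_iff_forall_adj_isBridge.mp h.2) (h.1.adj_inclusive h₁)
  rw [SimpleGraph.isBridge_iff] at hb
  apply hb
  have r₁ := h.1.reachable_deleteEdges (w := u₁) hx₁ (h.1.not_reflTransGen h₁)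
  have r₂ := h.1.reachable_deleteEdges (w := u₁) hx₂ (h.1.not_reflTransGen h₂)
  refine (r₁.symm.trans r₂).trans (SimpleGraph.Adj.reachable ?_)
  rw [SimpleGraph.deleteEdges_adj]
  refine ⟨h.1.adj_inclusive h₂, fun he => ?_⟩
  simp only [Set.mem_singleton_iff, Sym2.eq_iff] at he
  rcases he with ⟨e, _⟩ | ⟨_, e⟩
  · exact hne e.symm
  · exact h.1.ne h₁ e.symm

theorem closedPred_eq_of_list {v : V} {l : List V} (hl : ∀ u, u ∈ l ↔ G.Adj u v) :
    closedPred G v = {v} ∪ ⋃ u ∈ l, closedPred G u := by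
  ext x
  simp only [closedPred, Set.mem_ofPred_eq, Set.mem_union, Set.mem_singleton_iff, Set.mem_iUnion,
    hl, exists_prop]
  rw [Relation.ReflTransGen.cases_tail_iff]
  constructor
  · rintro (e | ⟨u, hu, huv⟩)
    · exact Or.inl e.symm
    · exact Or.inr ⟨u, huv, hu⟩
  · rintro (e | ⟨u, huv, hu⟩)
    · exact Or.inl e.symm
    · exact Or.inr ⟨u, hu, huv⟩

end Forest

/-! ### Cyclic layouts -/

/-- The residues modulo `k` of `x, x + 1, …, x + a - 1`. -/
def residues (k x a : ℕ) : Set ℕ := {y | ∃ j < a, y = (x + j) % k}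

theorem residues_union {k x a b : ℕ} (hk : 0 < k) (ha : a ≤ k) :
    residues k x a ∪ residues k ((x + a) % k) b = residues k x (min k (a + b)) := by
  ext y
  simp only [residues, Set.mem_union, Set.mem_ofPred_eq, Nat.mod_add_mod]
  constructor
  · rintro (⟨j, hj, rfl⟩ | ⟨j, hj, rfl⟩)
    · exact ⟨j, by omega, rfl⟩
    · by_cases h : a + j < k
      · exact ⟨a + j, by omega, by rw [Nat.add_assoc]⟩
      -- Here the offset exceeds the cap, so the capped length is `k` and every offset modulo `k` is
      -- allowed.
      · refine ⟨(a + j) % k, ?_, by rw [Nat.add_mod_mod, Nat.add_assoc]⟩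
        have := Nat.mod_lt (a + j) hk
        omega
  · rintro ⟨j, hj, rfl⟩
    by_cases h : j < a
    · exact Or.inl ⟨j, h, rfl⟩
    · exact Or.inr ⟨j - a, by omega, by rw [Nat.add_assoc, Nat.add_sub_cancel' (by omega)]⟩

/-- Starting with `a` occupied places from `s v` on, the in-neighbors in the list `l` get
consecutive places, and in the end `b` places are occupied; numbers of places are capped at `k`. -/
def Chain {V : Type*} (k : ℕ) (q s : V → ℕ) (v : V) : ℕ → List V → ℕ → Prop
  | a, [], b => b = a
  | a, u :: l, b => s u = (s v + a) % k ∧ Chain k q s v (min k (a + q u)) l b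

theorem Chain.congr {V : Type*} {k : ℕ} {q q' s s' : V → ℕ} {v : V} (hv : s v = s' v) :
    ∀ {l : List V} {a b : ℕ}, (∀ u ∈ l, q u = q' u ∧ s u = s' u) →
      Chain k q s v a l b → Chain k q' s' v a l b := by
  intro l
  induction l with
  | nil => exact fun _ h => h
  | cons u l ih =>
    intro a b hl h
    have h0 := hl u (by simp)
    refine ⟨by rw [← h0.2, ← hv]; exact h.1, ?_⟩
    rw [← h0.1]
    exact ih (fun u hu => hl u (by simp [hu])) h.2

theorem Chain.of_map {U V : Type*} {k : ℕ} {q s : V → ℕ} (f : U → V) {v : U} :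
    ∀ {l : List U} {a b : ℕ}, Chain k q s (f v) a (l.map f) b →
      Chain k (q ∘ f) (s ∘ f) v a l b := by
  intro l
  induction l with
  | nil => exact fun h => h
  | cons u l ih => exact fun h => ⟨h.1, ih h.2⟩

/-- Along the arcs, `q` and `s` are the sizes (capped at `k`) and the starting places of a cyclic
layout; `acc v` places from `s v` on are occupied beforehand. -/
def IsLayout {V : Type*} (k : ℕ) (r : V → V → Prop) (acc q s : V → ℕ) : Prop :=
  ∀ v, ∃ l : List V, l.Nodup ∧ (∀ u, u ∈ l ↔ r u v) ∧ Chain k q s v (acc v) l (q v)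

/-- Walking along the chain, the set `U` covered so far absorbs one set `P u` at a time:
disjointness makes the sizes add up, and `residues_union` glues the adjacent blocks. -/
theorem Chain.residues {V : Type*} [Finite V] {k : ℕ} {q s : V → ℕ} {v : V} (hk : 0 < k)
    {P : V → Set V} :
    ∀ {l : List V} {a b : ℕ} {U : Set V}, Chain k q s v a l b → a = min k U.ncard →
      s '' U = residues k (s v) a →
      (∀ u ∈ l, q u = min k (P u).ncard ∧ s '' P u = MinSumDissat.residues k (s u) (q u)) →
      l.Pairwise (fun u w => Disjoint (P u) (P w)) → (∀ u ∈ l, Disjoint U (P u)) →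
      b = min k (U ∪ ⋃ u ∈ l, P u).ncard ∧
        s '' (U ∪ ⋃ u ∈ l, P u) = MinSumDissat.residues k (s v) b := by
  intro l
  induction l with
  | nil =>
    intro a b U h ha hU _ _ _
    obtain rfl : b = a := h
    simpa using ⟨ha, hU⟩
  | cons u l ih =>
    intro a b U h ha hU hP hd hdU
    obtain ⟨hu, h⟩ := h
    obtain ⟨hq, hs⟩ := hP u (by simp)
    rw [List.pairwise_cons] at hd
    have e : U ∪ ⋃ w ∈ u :: l, P w = (U ∪ P u) ∪ ⋃ w ∈ l, P w := by
      simp [Set.union_assoc]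
    rw [e]
    refine ih h ?_ ?_ (fun w hw => hP w (by simp [hw])) hd.2 (fun w hw => ?_)
    · rw [Set.ncard_union_eq (hdU u (by simp)) (Set.toFinite _) (Set.toFinite _)]
      omega
    · rw [Set.image_union, hU, hs, hu, residues_union hk (by omega)]
    · rw [Set.disjoint_union_left]
      exact ⟨hdU w (by simp [hw]), hd.1 w hw⟩

section Layout

variable {V : Type*} {G : Digraph V} {k : ℕ} {q s : V → ℕ}

/-- Well-founded induction along the arcs: the vertex itself is the initial block of length one, and
the disjoint predecessor sets of its in-neighbors are appended by `Chain.residues`. -/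
theorem IsLayout.image_closedPred [Finite V] (hG : IsPolyforest G) (hk : 0 < k) (hs : ∀ v, s v < k)
    (h : IsLayout k G.Adj (fun _ => min 1 k) q s) (v : V) :
    q v = min k (closedPred G v).ncard ∧ s '' closedPred G v = residues k (s v) (q v) := by
  have : Std.Irrefl (Relation.TransGen G.Adj) := ⟨hG.1⟩
  have wf := Finite.wellFounded_of_trans_of_irrefl (Relation.TransGen G.Adj)
  induction v using wf.induction with
  | _ v ih =>
    obtain ⟨l, hl, hlv, hc⟩ := h v
    rw [closedPred_eq_of_list hlv]
    refine hc.residues hk ?_ ?_ (fun u hu => ih u (.single ((hlv u).1 hu))) ?_ ?_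
    · rw [Set.ncard_singleton, Nat.min_comm]
    · have : min 1 k = 1 := by omega
      rw [this]
      ext y
      simp only [Set.image_singleton, Set.mem_singleton_iff, residues, Set.mem_ofPred_eq,
        Nat.lt_one_iff, exists_eq_left, Nat.add_zero, Nat.mod_eq_of_lt (hs v)]
    · refine hl.imp_of_mem fun {u w} hu hw huw => ?_
      exact hG.disjoint_closedPred ((hlv u).1 hu) ((hlv w).1 hw) huw
    · intro u hu
      rw [Set.disjoint_singleton_left]
      exact hG.1.not_reflTransGen ((hlv u).1 hu)

/-- The allocation in which every item `v` goes to agent `s v`. -/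
def allocOf (k : ℕ) (s : V → ℕ) : Allocation k V where
  items i := {v | s v = i}
  disjoint i j hij := by
    rw [Set.disjoint_left]
    intro v hi hj
    exact hij (Fin.ext (hi.symm.trans hj))

/-- Adding `min 1 k` covers both codes without a case distinction in the program: agents are shifted
by one, and for `k = 0` the code stays 0, that of an unallocated item. -/
theorem labelCode_allocOf (hs : 0 < k → ∀ v, s v < k) (hs0 : k = 0 → ∀ v, s v = 0) (v : V) :
    labelCode ((allocOf k s).label v) = s v + min 1 k := by
  rcases Nat.eq_zero_or_pos k with rfl | hk
  · rw [hs0 rfl]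
    cases h : (allocOf 0 s).label v with
    | none => rfl
    | some i => exact i.elim0
  · have : (allocOf k s).label v = some ⟨s v, hs hk v⟩ := by
      rw [Allocation.label_eq_some_iff]
      rfl
    rw [this, labelCode]
    simp only
    omega

theorem dominates_allocOf {i : Fin k} {v : V} :
    Dominates G (allocOf k s) i v ↔ (i : ℕ) ∈ s '' closedPred G v := Iff.rfl

/-- The block either ends before `k`, giving an ordinary interval, or wraps around once, giving a
final and an initial piece. -/
theorem residues_eq_cyclicInterval {k x a : ℕ} (hx : x < k) (ha : 0 < a) (hak : a < k) :
    {i : Fin k | (i : ℕ) ∈ residues k x a} = cyclicInterval k x (x + a - 1 : ℕ) := by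
  ext ⟨i, hi⟩
  have e1 : ((x : ℕ) : ℤ) % k = x := by exact_mod_cast congrArg Nat.cast (Nat.mod_eq_of_lt hx)
  have hres : i ∈ residues k x a ↔ (x ≤ i ∧ i < x + a) ∨ i + k < x + a := by
    constructor
    · rintro ⟨j, hj, e⟩
      by_cases h : x + j < k
      · rw [Nat.mod_eq_of_lt h] at e; omega
      · rw [Nat.mod_eq_sub_mod (by omega), Nat.mod_eq_of_lt (by omega)] at e; omega
    · rintro (h | h)
      · exact ⟨i - x, by omega, by rw [Nat.add_sub_cancel' h.1, Nat.mod_eq_of_lt hi]⟩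
      · exact ⟨i + k - x, by omega, by
          rw [Nat.add_sub_cancel' (by omega), Nat.add_mod_right, Nat.mod_eq_of_lt hi]⟩
  simp only [Set.mem_ofPred_eq, hres, cyclicInterval, e1]
  by_cases h : x + a - 1 < k
  · have e2 : ((x + a - 1 : ℕ) : ℤ) % k = (x + a - 1 : ℕ) := by
      exact_mod_cast congrArg Nat.cast (Nat.mod_eq_of_lt h)
    rw [e2, if_pos (by omega)]
    omega
  · have e2 : ((x + a - 1 : ℕ) : ℤ) % k = (x + a - 1 - k : ℕ) := by
      rw [← Int.natCast_mod, Nat.mod_eq_sub_mod (by omega), Nat.mod_eq_of_lt (by omega)]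
    rw [e2, if_neg (by omega)]
    omega

theorem closedPred_ncard_pos [Finite V] (v : V) : 0 < (closedPred G v).ncard :=
  (Set.ncard_pos (Set.toFinite _)).mpr ⟨v, .refl⟩

theorem residues_ncard {k x a : ℕ} (ha : a ≤ k) : (residues k x a).ncard = a := by
  have : residues k x a = (fun j => (x + j) % k) '' (Finset.range a : Set ℕ) := by
    ext y
    simp [residues, eq_comm]
  rw [this, Set.InjOn.ncard_image, Set.ncard_coe_finset, Finset.card_range]
  intro i hi j hj e
  simp only [Finset.coe_range, Set.mem_Iio] at hi hj
  have := Nat.ModEq.add_left_cancel' x (show x + i ≡ x + j [MOD k] from e)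
  exact Nat.ModEq.eq_of_lt_of_lt this (by omega) (by omega)

/-- If pred[v] has fewer than `k` items, its block has as many places as items, so the labels are
distinct. Otherwise the block has length `k` and contains every agent. -/
theorem IsLayout.isGood [Finite V] (hG : IsPolyforest G) (hs : 0 < k → ∀ v, s v < k)
    (h : IsLayout k G.Adj (fun _ => min 1 k) q s) : IsGood G (allocOf k s) := by
  intro v
  rcases Nat.eq_zero_or_pos k with rfl | hk
  · exact Or.inl fun i => i.elim0
  have hs := hs hk
  obtain ⟨hq, hr⟩ := h.image_closedPred hG hk hs v
  have hp := closedPred_ncard_pos (G := G) v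
  rcases Nat.lt_or_ge (closedPred G v).ncard k with hlt | hge
  · right
    have hlab : ∀ u, (allocOf k s).label u = some ⟨s u, hs u⟩ := fun u => by
      rw [Allocation.label_eq_some_iff]; rfl
    refine ⟨fun u _ => by simp [hlab], ?_, s v, (s v + q v - 1 : ℕ), ?_⟩
    · have hinj : Set.InjOn s (closedPred G v) := by
        refine Set.injOn_of_ncard_image_eq ?_ (Set.toFinite _)
        rw [hr, residues_ncard (by omega)]
        omega
      intro u hu w hw e
      rw [hlab, hlab] at e
      exact hinj hu hw (by simpa using e)
    · simp only [dominates_allocOf, hr]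
      exact residues_eq_cyclicInterval (hs v) (by omega) (by omega)
  · left
    intro i
    rw [dominates_allocOf, hr, hq, Nat.min_eq_left hge]
    -- The offset of agent `i` from `s v` modulo `k`.
    refine ⟨(i + (k - s v)) % k, Nat.mod_lt _ hk, ?_⟩
    rw [Nat.add_mod_mod, Nat.add_left_comm, Nat.add_sub_cancel' (hs v).le, Nat.add_mod_right,
      Nat.mod_eq_of_lt i.2]

end Layout

/-! ### The total dissatisfaction -/

section Total

variable {V : Type*} {G : Digraph V} [Fintype V] {k : ℕ}

/-- The pairs of an agent and an item it does not dominate are counted by item instead of by agent.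
-/
theorem totalDissatisfaction_eq_sum (π : Allocation k V) :
    totalDissatisfaction G π = ∑ v, (k - {i | Dominates G π i v}.ncard) := by
  classical
  have e1 : ∀ i, dissatisfaction G π i = ∑ v, if ¬ Dominates G π i v then 1 else 0 := by
    intro i
    rw [dissatisfaction, Set.ncard_eq_toFinset_card', Finset.sum_boole]
    simp
  have e2 : ∀ v, (∑ i, if ¬ Dominates G π i v then 1 else 0) =
      k - {i | Dominates G π i v}.ncard := by
    intro v
    rw [Finset.sum_boole, Set.ncard_eq_toFinset_card']
    have := Finset.card_filter_add_card_filter_not (s := (Finset.univ : Finset (Fin k)))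
      (fun i => Dominates G π i v)
    rw [Finset.card_univ, Fintype.card_fin] at this
    simp only [Set.toFinset_ofPred, Nat.cast_id]
    omega
  rw [totalDissatisfaction, Finset.sum_congr rfl fun i _ => e1 i, Finset.sum_comm]
  exact Finset.sum_congr rfl fun v _ => e2 v

/-- Every dominating agent is the label of some item of pred[v], so there are no more such agents
than items. -/
theorem ncard_dominates_le (π : Allocation k V) (v : V) :
    {i | Dominates G π i v}.ncard ≤ min k (closedPred G v).ncard := by
  refine le_min ?_ ?_
  · exact (Set.ncard_le_card _).trans_eq (by simp)
  · have hsub : some '' {i | Dominates G π i v} ⊆ π.label '' closedPred G v := by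
      rintro _ ⟨i, ⟨u, hu, hi⟩, rfl⟩
      exact ⟨u, hu, (π.label_eq_some_iff u i).2 hi⟩
    rw [← Set.ncard_image_of_injective _ (Option.some_injective _)]
    exact (Set.ncard_le_ncard hsub (Set.toFinite _)).trans (Set.ncard_image_le (Set.toFinite _))

theorem IsGood.ncard_dominates {π : Allocation k V} (h : IsGood G π) (v : V) :
    {i | Dominates G π i v}.ncard = min k (closedPred G v).ncard := by
  refine le_antisymm (ncard_dominates_le π v) ?_
  rcases h v with h | ⟨h, hinj, -⟩
  · rw [Set.eq_univ_of_forall (s := {i | Dominates G π i v}) h, Set.ncard_univ, Nat.card_fin]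
    exact min_le_left _ _
  · refine (min_le_right _ _).trans ?_
    rw [← hinj.ncard_image, ← Set.ncard_image_of_injective {i | Dominates G π i v}
      (Option.some_injective _)]
    refine Set.ncard_le_ncard ?_ (Set.toFinite _)
    rintro _ ⟨u, hu, rfl⟩
    obtain ⟨i, hi⟩ := Option.ne_none_iff_exists.mp (h u hu)
    exact ⟨i, ⟨u, hu, (π.label_eq_some_iff u i).1 hi.symm⟩, hi⟩

theorem IsGood.totalDissatisfaction_eq {π : Allocation k V} (h : IsGood G π) :
    totalDissatisfaction G π = ∑ v, (k - min k (closedPred G v).ncard) := by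
  rw [totalDissatisfaction_eq_sum]
  simp only [h.ncard_dominates]

theorem IsGood.isOptimal {π : Allocation k V} (h : IsGood G π) : IsOptimal G π := by
  intro π'
  rw [h.totalDissatisfaction_eq, totalDissatisfaction_eq_sum]
  exact Finset.sum_le_sum fun v _ => Nat.sub_le_sub_left (ncard_dominates_le π' v) k

theorem IsLayout.totalDissatisfaction_eq {q s : V → ℕ} (hG : IsPolyforest G)
    (hs : 0 < k → ∀ v, s v < k) (h : IsLayout k G.Adj (fun _ => min 1 k) q s) :
    totalDissatisfaction G (allocOf k s) = ∑ v, (k - q v) := by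
  rw [(h.isGood hG hs).totalDissatisfaction_eq]
  refine Finset.sum_congr rfl fun v _ => ?_
  rcases Nat.eq_zero_or_pos k with rfl | hk
  · simp
  · rw [(h.image_closedPred hG hk (hs hk) v).1]

end Total

/-! ### Leaves of forests -/

/-- The number of arcs in `F` with tail `v`. -/
def outDegree (F : Multiset (ℕ × ℕ)) (v : ℕ) : ℕ := (F.map fun e => if e.1 = v then 1 else 0).sum

/-- The number of ends at `v` of arcs in `F`. -/
def degree (F : Multiset (ℕ × ℕ)) (v : ℕ) : ℕ :=
  (F.map fun e => (if e.1 = v then 1 else 0) + if e.2 = v then 1 else 0).sum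

/-- The sum of the values of `f` at the other ends of the arcs of `F` at `v`. -/
def neighborSum (f : ℕ → ℕ) (F : Multiset (ℕ × ℕ)) (v : ℕ) : ℕ :=
  (F.map fun e => (if e.1 = v then f e.2 else 0) + if e.2 = v then f e.1 else 0).sum

theorem outDegree_cons (e : ℕ × ℕ) (F : Multiset (ℕ × ℕ)) (v : ℕ) :
    outDegree (e ::ₘ F) v = (if e.1 = v then 1 else 0) + outDegree F v := by
  simp [outDegree]

theorem degree_cons (e : ℕ × ℕ) (F : Multiset (ℕ × ℕ)) (v : ℕ) :
    degree (e ::ₘ F) v = (if e.1 = v then 1 else 0) + (if e.2 = v then 1 else 0) + degree F v := by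
  simp [degree]

theorem neighborSum_cons (f : ℕ → ℕ) (e : ℕ × ℕ) (F : Multiset (ℕ × ℕ)) (v : ℕ) :
    neighborSum f (e ::ₘ F) v =
      (if e.1 = v then f e.2 else 0) + (if e.2 = v then f e.1 else 0) + neighborSum f F v := by
  simp [neighborSum]

theorem degree_eq_zero {F : Multiset (ℕ × ℕ)} {v : ℕ} :
    degree F v = 0 ↔ ∀ e ∈ F, e.1 ≠ v ∧ e.2 ≠ v := by
  induction F using Multiset.induction_on with
  | empty => simp [degree]
  | cons e F ih =>
    rw [degree_cons, Nat.add_eq_zero_iff, ih]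
    simp

theorem outDegree_eq_zero {F : Multiset (ℕ × ℕ)} {v : ℕ} (h : ∀ e ∈ F, e.1 ≠ v) :
    outDegree F v = 0 := by
  induction F using Multiset.induction_on with
  | empty => rfl
  | cons e F ih =>
    rw [outDegree_cons, if_neg (h e (Multiset.mem_cons_self _ _)),
      ih fun e' he' => h e' (Multiset.mem_cons_of_mem he')]

theorem neighborSum_eq_zero {f : ℕ → ℕ} {F : Multiset (ℕ × ℕ)} {v : ℕ}
    (h : ∀ e ∈ F, e.1 ≠ v ∧ e.2 ≠ v) : neighborSum f F v = 0 := by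
  induction F using Multiset.induction_on with
  | empty => rfl
  | cons e F ih =>
    have := h e (Multiset.mem_cons_self _ _)
    simp [neighborSum_cons, this, ih fun e' he' => h e' (Multiset.mem_cons_of_mem he')]

/-- The arc between a leaf `x` and its neighbor `w`, directed away from `x` if `b` holds. -/
def leafArc (x w : ℕ) (b : Bool) : ℕ × ℕ := if b then (x, w) else (w, x)

theorem exists_leafArc {F : Multiset (ℕ × ℕ)} {x : ℕ} (h : degree F x = 1) :
    ∃ w b F', F = leafArc x w b ::ₘ F' ∧ w ≠ x ∧ ∀ e ∈ F', e.1 ≠ x ∧ e.2 ≠ x := by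
  have hne : ¬ degree F x = 0 := by omega
  rw [degree_eq_zero] at hne
  push Not at hne
  obtain ⟨⟨u, v⟩, he, hx⟩ := hne
  obtain ⟨F', rfl⟩ := Multiset.exists_cons_of_mem he
  rw [degree_cons] at h
  by_cases hu : u = x
  · subst hu
    simp only [if_true] at h
    have hv : v ≠ u := fun e => by simp only [e, if_true] at h; omega
    exact ⟨v, true, F', rfl, hv, degree_eq_zero.1 (by omega)⟩
  · have hv : v = x := hx hu
    subst hv
    simp only [if_true] at h
    exact ⟨u, false, F', rfl, hu, degree_eq_zero.1 (by omega)⟩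

/-- Every nonempty part of `E` has a vertex of degree one. -/
def HasLeaves (E : Multiset (ℕ × ℕ)) : Prop := ∀ F ≤ E, F ≠ 0 → ∃ x, degree F x = 1

theorem HasLeaves.mono {E E' : Multiset (ℕ × ℕ)} (h : HasLeaves E) (hE : E' ≤ E) :
    HasLeaves E' := fun F hF => h F (hF.trans hE)

/-- Removing a leaf with its arc loses one vertex and one arc. This bounds the number of arcs by the
number of items, so that times linear in both are linear in `n`. -/
theorem HasLeaves.card_le {F : Multiset (ℕ × ℕ)} (h : HasLeaves F) :
    ∀ U : Finset ℕ, (∀ e ∈ F, e.1 ∈ U ∧ e.2 ∈ U) → F.card ≤ U.card := by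
  induction F using Multiset.strongInductionOn with
  | ih F ih =>
    intro U hU
    by_cases hF : F = 0
    · simp [hF]
    obtain ⟨x, hx⟩ := h F le_rfl hF
    obtain ⟨w, b, F', rfl, hw, hF'⟩ := exists_leafArc hx
    have hlt := Multiset.lt_cons_self F' (leafArc x w b)
    have hxU : x ∈ U := by
      have := hU _ (Multiset.mem_cons_self _ _)
      cases b
      · exact this.2
      · exact this.1
    have := ih F' hlt (h.mono hlt.le) (U.erase x) fun e he => by
      have h1 := hU e (Multiset.mem_cons_of_mem he)
      have h2 := hF' e he
      simp [h1, h2]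
    rw [Finset.card_erase_of_mem hxU] at this
    have := Finset.card_pos.mpr ⟨x, hxU⟩
    rw [Multiset.card_cons]
    omega

/-- A finite acyclic graph with an edge has a vertex with exactly one neighbor. -/
theorem exists_unique_neighbor {V : Type*} [Finite V] {H : SimpleGraph V} (h : H.IsAcyclic)
    {a b : V} (hab : H.Adj a b) : ∃ x w, H.Adj x w ∧ ∀ w', H.Adj x w' → w' = w := by
  have : Nonempty V := ⟨a⟩
  obtain ⟨u, v, p, hp, hmax⟩ := SimpleGraph.Walk.exists_isPath_forall_isPath_length_le_length H
  have hlen : 1 ≤ p.length := by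
    have := hmax _ _ hab.toWalk (by simpa using hab.ne)
    simpa using this
  have hnil : ¬ p.Nil := by
    rw [← SimpleGraph.Walk.length_eq_zero_iff]
    omega
  refine ⟨u, p.snd, p.adj_snd hnil, fun w' hw' => ?_⟩
  -- A second neighbor of the start of a longest path would close a cycle if it lies on the path,
  -- and would lengthen the path otherwise.
  by_cases hs : w' ∈ p.support
  · exact h.eq_snd_of_adj_start hp hw' hs
  · have := hmax _ _ (SimpleGraph.Walk.cons hw'.symm p) (hp.cons hs)
    simp at this

/-- The arcs with vertices as natural numbers. -/
def natArcs {n : ℕ} (arcs : List (Fin n × Fin n)) : List (ℕ × ℕ) :=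
  arcs.map fun e => ((e.1 : ℕ), (e.2 : ℕ))

theorem mem_natArcs {n : ℕ} {G : Digraph (Fin n)} {arcs : List (Fin n × Fin n)}
    (h : IsArcList G arcs) {e : ℕ × ℕ} :
    e ∈ natArcs arcs ↔ ∃ u v : Fin n, G.Adj u v ∧ e = ((u : ℕ), (v : ℕ)) := by
  simp only [natArcs, List.mem_map, Prod.exists, h.2, eq_comm]

/-- The arcs of `F` span a subgraph of the forest, which has a vertex with a single neighbor. Its
degree in `F` is one because arcs are listed once and acyclicity excludes opposite arcs. -/
theorem IsPolyforest.hasLeaves {n : ℕ} {G : Digraph (Fin n)} {arcs : List (Fin n × Fin n)}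
    (hG : IsPolyforest G) (h : IsArcList G arcs) :
    HasLeaves (natArcs arcs : Multiset (ℕ × ℕ)) := by
  intro F hF hne
  have hnd : F.Nodup := by
    refine Multiset.nodup_of_le hF ?_
    rw [Multiset.coe_nodup]
    refine h.1.map ?_
    rintro ⟨a, b⟩ ⟨c, d⟩ e
    simp only [Prod.mk.injEq] at e
    exact Prod.ext (Fin.ext e.1) (Fin.ext e.2)
  have hadj : ∀ e ∈ F, ∃ u v : Fin n, G.Adj u v ∧ e = ((u : ℕ), (v : ℕ)) := fun e he =>
    (mem_natArcs h).1 (Multiset.mem_coe.1 (Multiset.mem_of_le hF he))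
  have hFG : ∀ u v : Fin n, ((u : ℕ), (v : ℕ)) ∈ F → G.Adj u v := by
    intro u v huv
    obtain ⟨u', v', h', e⟩ := hadj _ huv
    simp only [Prod.mk.injEq] at e
    rwa [Fin.ext e.1, Fin.ext e.2]
  let H : SimpleGraph (Fin n) := SimpleGraph.fromRel fun u v => ((u : ℕ), (v : ℕ)) ∈ F
  have hle : H ≤ G.toSimpleGraphInclusive := by
    intro u v huv
    exact ⟨huv.1, huv.2.imp (hFG u v) (hFG v u)⟩
  have hH : H.IsAcyclic := hG.2.anti hle
  obtain ⟨e, he⟩ := Multiset.exists_mem_of_ne_zero hne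
  obtain ⟨a, b, hab, rfl⟩ := hadj e he
  obtain ⟨x, w, ⟨hxw, hF1⟩, huniq⟩ := exists_unique_neighbor hH (a := a) (b := b)
    ⟨hG.1.ne hab, Or.inl he⟩
  have hanti : ∀ u v : Fin n, ((u : ℕ), (v : ℕ)) ∈ F → ((v : ℕ), (u : ℕ)) ∉ F := fun u v h1 h2 =>
    hG.1.not_reflTransGen (hFG _ _ h1) (.single (hFG _ _ h2))
  have hother : ∀ e ∈ F, e.1 = x ∨ e.2 = x → e = ((x : ℕ), (w : ℕ)) ∨ e = ((w : ℕ), (x : ℕ)) := by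
    intro e he hx
    obtain ⟨u, v, huv, rfl⟩ := hadj e he
    rcases hx with hx | hx
    · obtain rfl : u = x := Fin.ext hx
      rw [huniq v ⟨hG.1.ne huv, Or.inl he⟩]
      exact Or.inl rfl
    · obtain rfl : v = x := Fin.ext hx
      rw [huniq u ⟨(hG.1.ne huv).symm, Or.inr he⟩]
      exact Or.inr rfl
  have hval : (x : ℕ) ≠ w := fun e => hxw (Fin.ext e)
  refine ⟨x, ?_⟩
  rcases hF1 with hF1 | hF1
  all_goals
    have hopp := hanti _ _ hF1
    obtain ⟨F', rfl⟩ := Multiset.exists_cons_of_mem hF1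
    rw [Multiset.nodup_cons] at hnd
    have h0 : degree F' x = 0 := by
      rw [degree_eq_zero]
      intro e he
      by_contra hx
      have hx' : e.1 = x ∨ e.2 = x := by tauto
      rcases hother e (Multiset.mem_cons_of_mem he) hx' with rfl | rfl
      · first
        | exact hnd.1 he
        | exact hopp (Multiset.mem_cons_of_mem he)
      · first
        | exact hnd.1 he
        | exact hopp (Multiset.mem_cons_of_mem he)
    rw [degree_cons, h0]
    simp [hval.symm]

/-! ### Extending layouts by leaves -/

section Extend

variable {k x w : ℕ} {P : Multiset (ℕ × ℕ)} {acc q s : ℕ → ℕ}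

/-- A leaf with an arc to its neighbor `w` takes the first free place of `w`. -/
theorem IsLayout.extend_tail (hxw : w ≠ x) (hP : ∀ e ∈ P, e.1 ≠ x ∧ e.2 ≠ x)
    (h : IsLayout k (fun u v => (u, v) ∈ P)
      (Function.update acc w (min k (acc w + acc x))) q s) :
    IsLayout k (fun u v => (u, v) ∈ leafArc x w true ::ₘ P) acc q
      (Function.update s x ((s w + acc w) % k)) := by
  have hq : q x = acc x := by
    obtain ⟨l, -, hl, hc⟩ := h x
    obtain rfl : l = [] := List.eq_nil_iff_forall_not_mem.mpr fun u hu =>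
      (hP _ ((hl u).1 hu)).2 rfl
    simpa [Chain, Function.update_of_ne hxw.symm] using hc
  intro v
  obtain ⟨l, hnd, hl, hc⟩ := h v
  have hs : ∀ u ∈ l, q u = q u ∧ s u = Function.update s x ((s w + acc w) % k) u :=
    fun u hu => ⟨rfl, (Function.update_of_ne (hP _ ((hl u).1 hu)).1 _ _).symm⟩
  by_cases hv : v = w
  · subst hv
    -- The leaf goes to the front of the list: the rest of the chain of `w` then starts at the
    -- increased value of `acc w`.
    refine ⟨x :: l, ?_, fun u => ?_, ?_, ?_⟩
    · exact List.nodup_cons.mpr ⟨fun hx => (hP _ ((hl x).1 hx)).1 rfl, hnd⟩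
    · simp [leafArc, hl]
    · simp [Function.update_of_ne hxw]
    · rw [Function.update_self] at hc
      rw [hq]
      exact hc.congr (Function.update_of_ne hxw _ _).symm hs
  · refine ⟨l, hnd, fun u => by simp [leafArc, hl, hv], ?_⟩
    rw [Function.update_of_ne hv] at hc
    by_cases hvx : v = x
    · subst hvx
      obtain rfl : l = [] := List.eq_nil_iff_forall_not_mem.mpr fun u hu =>
        (hP _ ((hl u).1 hu)).2 rfl
      exact hc
    · exact hc.congr (Function.update_of_ne hvx _ _).symm hs

/-- A leaf with an arc from its neighbor `w` is placed so that `w` takes its first free place. -/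
theorem IsLayout.extend_head (hxw : w ≠ x) (hP : ∀ e ∈ P, e.1 ≠ x ∧ e.2 ≠ x) (hacc : acc x ≤ k)
    (hs : s w % k = s w) (h : IsLayout k (fun u v => (u, v) ∈ P) acc q s) :
    IsLayout k (fun u v => (u, v) ∈ leafArc x w false ::ₘ P) acc
      (Function.update q x (min k (q x + q w)))
      (Function.update s x ((s w + (k - acc x)) % k)) := by
  have hq : q x = acc x := by
    obtain ⟨l, -, hl, hc⟩ := h x
    obtain rfl : l = [] := List.eq_nil_iff_forall_not_mem.mpr fun u hu =>
      (hP _ ((hl u).1 hu)).2 rfl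
    simpa [Chain] using hc
  intro v
  obtain ⟨l, hnd, hl, hc⟩ := h v
  by_cases hv : v = x
  · subst hv
    obtain rfl : l = [] := List.eq_nil_iff_forall_not_mem.mpr fun u hu =>
      (hP _ ((hl u).1 hu)).2 rfl
    -- Adding `k - acc x` subtracts `acc x` modulo `k`, so `w` lands just behind the places reserved
    -- at `x`.
    refine ⟨[w], List.nodup_singleton _, fun u => ?_, ?_, ?_⟩
    · have := hl u
      simp only [List.not_mem_nil, false_iff] at this
      simp [leafArc, this]
    · rw [Function.update_of_ne hxw, Function.update_self, Nat.mod_add_mod, Nat.add_assoc,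
        Nat.sub_add_cancel hacc, Nat.add_mod_right, hs]
    · rw [Function.update_of_ne hxw, hq]
      simp [Chain]
  · refine ⟨l, hnd, fun u => by simp [leafArc, hl, hv], ?_⟩
    rw [Function.update_of_ne hv]
    refine hc.congr (Function.update_of_ne hv _ _).symm fun u hu => ?_
    have hux := (hP _ ((hl u).1 hu)).1
    exact ⟨(Function.update_of_ne hux _ _).symm, (Function.update_of_ne hux _ _).symm⟩

end Extend

/-! ### The stack of removed leaves -/

/-- The numbers of occupied places, capped at `k`, after the removal of leaves. An entry
`(x, w, b)` of the list is a removed leaf, its neighbor and whether the arc goes to the neighbor;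
the leaf that was removed last comes first. -/
def stackAcc (k : ℕ) : List (ℕ × ℕ × Bool) → ℕ → ℕ
  | [] => fun _ => min 1 k
  | (x, w, b) :: K =>
    if b then Function.update (stackAcc k K) w (min k (stackAcc k K w + stackAcc k K x))
    else stackAcc k K

theorem stackAcc_le (k : ℕ) (K : List (ℕ × ℕ × Bool)) : ∀ v, stackAcc k K v ≤ k := by
  induction K with
  | nil => exact fun _ => min_le_right _ _
  | cons e K ih =>
    obtain ⟨x, w, b⟩ := e
    intro v
    cases b
    · exact ih v
    · simp only [stackAcc, if_true, Function.update_apply]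
      split_ifs
      · exact min_le_left _ _
      · exact ih v

/-- The arcs of the removed leaves. -/
def stackArcs (K : List (ℕ × ℕ × Bool)) : Multiset (ℕ × ℕ) :=
  (K.map fun e => leafArc e.1 e.2.1 e.2.2 : List (ℕ × ℕ))

theorem stackArcs_cons (x w : ℕ) (b : Bool) (K : List (ℕ × ℕ × Bool)) :
    stackArcs ((x, w, b) :: K) = leafArc x w b ::ₘ stackArcs K := rfl

/-- The address of the field `f` of the record of `v`, in a table of records of eight words that
starts at the address `B`. -/
def fld (B v f : ℕ) : ℕ := B + 8 * v + f

theorem fld_add (B v f : ℕ) : fld B v 0 + f = fld B v f := rfl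

theorem fld_inj {B v w f g : ℕ} (hf : f < 8) (hg : g < 8) :
    fld B v f = fld B w g ↔ v = w ∧ f = g := by
  simp only [fld]
  omega

/-- The memory holds, linked from the address `top` on, the records of the removed leaves. The
fields 1, 2, 5 and 6 of a record hold the direction of the arc, the neighbor, the offset of the
place of the leaf from the place of the neighbor, and the link. -/
def IsStack (k B : ℕ) (mem : ℕ → ℕ) : ℕ → List (ℕ × ℕ × Bool) → Prop
  | top, [] => top = 0
  | top, (x, w, b) :: K =>
    top = fld B x 0 ∧ mem (fld B x 1) = b.toNat ∧ mem (fld B x 2) = fld B w 0 ∧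
      mem (fld B x 5) = (if b then stackAcc k K w else k - stackAcc k K x) ∧
      -- The leaves in `K` were removed before `x`, while `w` was still present; hence `w` already
      -- has its final place when `x` is popped.
      IsStack k B mem (mem (fld B x 6)) K ∧ w ≠ x ∧ ∀ e ∈ K, e.1 ≠ x ∧ e.1 ≠ w

/-- A frame property: records of vertices outside the stack may be overwritten. -/
theorem IsStack.congr {k B : ℕ} {mem mem' : ℕ → ℕ} {K : List (ℕ × ℕ × Bool)} :
    ∀ {top : ℕ}, (∀ e ∈ K, ∀ f < 8, mem' (fld B e.1 f) = mem (fld B e.1 f)) →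
      IsStack k B mem top K → IsStack k B mem' top K := by
  induction K with
  | nil => exact fun _ h => h
  | cons e K ih =>
    obtain ⟨x, w, b⟩ := e
    intro top he h
    have hx := he (x, w, b) (by simp)
    simp only at hx
    obtain ⟨h1, h2, h3, h4, h5, h6⟩ := h
    refine ⟨h1, ?_, ?_, ?_, ?_, h6⟩
    · rw [hx 1 (by omega), h2]
    · rw [hx 2 (by omega), h3]
    · rw [hx 5 (by omega), h4]
    · rw [hx 6 (by omega)]
      exact ih (fun e' he' => he e' (by simp [he'])) h5

theorem neighborSum_le {f : ℕ → ℕ} {M : ℕ} {F : Multiset (ℕ × ℕ)}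
    (h : ∀ e ∈ F, f e.1 ≤ M ∧ f e.2 ≤ M ∧ e.1 ≠ e.2) (v : ℕ) :
    neighborSum f F v ≤ F.card * M := by
  induction F using Multiset.induction_on with
  | empty => simp [neighborSum]
  | cons e F ih =>
    have h1 := h e (Multiset.mem_cons_self _ _)
    have h2 := ih fun e' he' => h e' (Multiset.mem_cons_of_mem he')
    rw [neighborSum_cons, Multiset.card_cons, Nat.succ_mul]
    split_ifs with h3 h4
    · exact (h1.2.2 (h3.trans h4.symm)).elim
    all_goals omega

theorem degree_le {F : Multiset (ℕ × ℕ)} (v : ℕ) : degree F v ≤ 2 * F.card := by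
  induction F using Multiset.induction_on with
  | empty => simp [degree]
  | cons e F ih =>
    rw [degree_cons, Multiset.card_cons]
    split_ifs <;> omega

theorem outDegree_le {F : Multiset (ℕ × ℕ)} (v : ℕ) : outDegree F v ≤ F.card := by
  induction F using Multiset.induction_on with
  | empty => simp [outDegree]
  | cons e F ih =>
    rw [outDegree_cons, Multiset.card_cons]
    split_ifs <;> omega

/-! ### The program -/

open Cmd in
/-- The registers `0, …, 6` hold their own numbers, register `7` holds `8`; then come `k`,
`k - min 1 k`, `min 1 k`, the address of the table of records, the address of its end, and the
sign and the absolute value of `d`. -/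
def setup : Cmd := block
  [const 1 1, const 2 2, const 3 3, const 4 4, const 5 5, const 6 6, const 7 8,
    load 9 1, sub 17 1 9, sub 11 1 17, sub 10 9 11, load 17 0, load 18 4,
    add 18 18 18, add 12 18 17, add 12 12 5, add 23 18 5,
    add 17 17 17, add 17 17 17, add 17 17 17, add 13 12 17,
    load 24 2, load 25 3, add 22 5 0, sub 16 23 22]

open Cmd in
/-- Reads one arc and enters it into the records of its ends. -/
def arcStep : Cmd := block
  [load 17 22, add 18 22 1, load 18 18,
    add 17 17 17, add 17 17 17, add 17 17 17, add 17 12 17,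
    add 18 18 18, add 18 18 18, add 18 18 18, add 18 12 18,
    load 19 17, add 19 19 1, store 17 19,
    load 19 18, add 19 19 1, store 18 19,
    add 20 17 1, load 19 20, add 19 19 1, store 20 19,
    add 20 17 2, load 19 20, add 19 19 18, store 20 19,
    add 20 18 2, load 19 20, add 19 19 17, store 20 19,
    add 22 22 2, sub 16 23 22]

/-- The constant registers have their values. -/
def Consts (n k B sgn d : ℕ) (s : Store) : Prop :=
  s.reg 0 = 0 ∧ s.reg 1 = 1 ∧ s.reg 2 = 2 ∧ s.reg 3 = 3 ∧ s.reg 4 = 4 ∧ s.reg 5 = 5 ∧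
    s.reg 6 = 6 ∧ s.reg 7 = 8 ∧ s.reg 9 = k ∧ s.reg 10 = k - min 1 k ∧ s.reg 11 = min 1 k ∧
    s.reg 12 = B ∧ s.reg 13 = fld B n 0 ∧ s.reg 24 = sgn ∧ s.reg 25 = d

/-- The word size `W` suffices for `n` items, `m` arcs and `k` agents. -/
def Fits (n k m B W : ℕ) : Prop :=
  B + 8 * n + 16 ≤ W ∧ 2 * k + 1 ≤ W ∧ m * (B + 8 * n) ≤ W ∧ 2 * m ≤ W ∧ n * k + 1 ≤ W

/-! ### Reading the arcs -/

section Loops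

variable {n k B W sgn d : ℕ}

theorem eight_mul_add (B v : ℕ) : B + (v + v + (v + v) + (v + v + (v + v))) = fld B v 0 := by
  simp only [fld]; omega

theorem fld_ne_of_lt {B a : ℕ} (h : a < B) (v f : ℕ) : a ≠ fld B v f := by
  simp only [fld]; omega

/-- The invariant of the loop over the arcs, when `i` arcs are still to be read. -/
def ArcInv (n k B sgn d : ℕ) (arcs : List (ℕ × ℕ)) (mem₀ : ℕ → ℕ) (i : ℕ) (s : Store) : Prop :=
  Consts n k B sgn d s ∧ ∃ (j : ℕ) (F : Multiset (ℕ × ℕ)), j + i = arcs.length ∧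
    F + (arcs.drop j : Multiset (ℕ × ℕ)) = arcs ∧
    s.reg 22 = 5 + 2 * j ∧ s.reg 23 = 5 + 2 * arcs.length ∧ s.reg 16 = s.reg 23 - s.reg 22 ∧
    (∀ a < B, s.mem a = mem₀ a) ∧
    ∀ v, s.mem (fld B v 0) = degree F v ∧ s.mem (fld B v 1) = outDegree F v ∧
      s.mem (fld B v 2) = neighborSum (fun u => fld B u 0) F v ∧ s.mem (fld B v 3) = 0 ∧
      s.mem (fld B v 4) = 0

theorem arcStep_spec {arcs : List (ℕ × ℕ)} {mem₀ : ℕ → ℕ} (hW : Fits n k arcs.length B W)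
    (hB : 5 + 2 * arcs.length ≤ B) (hn : ∀ e ∈ arcs, e.1 < n ∧ e.2 < n ∧ e.1 ≠ e.2)
    (hmem : ∀ j (h : j < arcs.length), mem₀ (5 + 2 * j) = arcs[j].1 ∧
      mem₀ (5 + 2 * j + 1) = arcs[j].2)
    (i : ℕ) (s : Store) (h : ArcInv n k B sgn d arcs mem₀ i s) (h16 : s.reg 16 ≠ 0) :
    arcStep.wp W (fun s' => ∃ j < i, ArcInv n k B sgn d arcs mem₀ j s') s := by
  obtain ⟨⟨c0, c1, c2, c3, c4, c5, c6, c7, c9, c10, c11, c12, c13, c24, c25⟩, j, F, hji, hF, h22,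
    h23, hf, hlow, hrec⟩ := h
  have hj : j < arcs.length := by omega
  obtain ⟨m1, m2⟩ := hmem j hj
  rw [← hlow _ (by omega)] at m1 m2
  have hd := List.drop_eq_getElem_cons hj
  have he := hn _ (List.getElem_mem hj)
  rw [hd, ← Multiset.cons_coe, Multiset.add_cons, ← Multiset.cons_add] at hF
  have hmemF : ∀ e ∈ arcs[j] ::ₘ F, e.1 < n ∧ e.2 < n ∧ e.1 ≠ e.2 := fun e he => by
    refine hn e ?_
    rw [← Multiset.mem_coe, ← hF]
    exact Multiset.mem_add.2 (Or.inl he)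
  have hcard : (arcs[j] ::ₘ F).card ≤ arcs.length := by
    have := congrArg Multiset.card hF
    rw [Multiset.card_add, Multiset.coe_card, Multiset.coe_card] at this
    omega
  generalize arcs[j] = e at *
  obtain ⟨u, v⟩ := e
  simp only at m1 m2 he
  obtain ⟨hu, hv, huv⟩ := he
  -- The updated words belong to the arcs read so far including the new one, a part of all arcs; the
  -- bounds in `Fits` therefore apply after the update.
  have hS : ∀ x, neighborSum (fun u => fld B u 0) ((u, v) ::ₘ F) x ≤ W := fun x =>
    (neighborSum_le (M := B + 8 * n) (fun e he => by
      have := hmemF e he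
      simp only [fld]
      omega) x).trans ((Nat.mul_le_mul_right _ hcard).trans hW.2.2.1)
  have hD : ∀ x, degree ((u, v) ::ₘ F) x ≤ W := fun x =>
    (degree_le x).trans ((Nat.mul_le_mul_left 2 hcard).trans hW.2.2.2.1)
  have hO : ∀ x, outDegree ((u, v) ::ₘ F) x ≤ W := fun x =>
    (outDegree_le x).trans (hcard.trans (by have := hW.2.2.2.1; omega))
  have S1 := hS u
  have S2 := hS v
  have D1 := hD u
  have D2 := hD v
  have O1 := hO u
  have fu : fld B u 0 ≤ B + 8 * n := by simp only [fld]; omega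
  have fv : fld B v 0 ≤ B + 8 * n := by simp only [fld]; omega
  obtain ⟨w1, -⟩ := hW
  have hu1 : fld B u 1 = fld B u 0 + 1 := rfl
  have hu2 : fld B u 2 = fld B u 0 + 2 := rfl
  have hv2 : fld B v 2 = fld B v 0 + 2 := rfl
  simp only [neighborSum_cons, degree_cons, outDegree_cons, if_true, huv, huv.symm, if_false,
    Nat.add_zero, Nat.zero_add] at S1 S2 D1 D2 O1
  have r0 := fun v => (hrec v).1
  have r1 := fun v => (hrec v).2.1
  have r2 := fun v => (hrec v).2.2.1
  have f0 : fld B u 0 = B + 8 * u := rfl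
  have f1 : fld B v 0 = B + 8 * v := rfl
  simp [arcStep, Cmd.block, Cmd.wp, Store.setReg, Store.setMem, c1, c2, c12, h22, h23, m1, m2, r0,
    r1, r2, huv, huv.symm, eight_mul_add, fld_add, fld_inj]
  refine ⟨by omega, by omega, by omega, by omega, by omega, by omega, by omega, by omega, by omega,
    by omega, by omega, by omega, by omega, by omega, by omega, by omega, by omega, by omega,
    i - 1, by omega, ?_, j + 1, (u, v) ::ₘ F, by omega, hF, ?_, ?_, ?_, ?_, ?_⟩
  · simp [Consts, *]
  · simp
    omega
  · simp [h23]
  · simp [h23]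
  · intro a ha
    simp [fld_ne_of_lt ha, hlow a ha]
  · intro x
    simp only [Function.update_apply, fld_inj, Nat.reduceLT, outDegree_cons, degree_cons,
      neighborSum_cons, hrec, eq_comm (a := x)]
    refine ⟨?_, ?_, ?_, ?_, ?_⟩
    all_goals
      by_cases hxu : u = x
      · have hxv : v ≠ x := fun e => huv (hxu.trans e.symm)
        simp [hxu, hxv, Nat.add_comm]
      · by_cases hxv : v = x <;> simp [hxu, hxv, Nat.add_comm]

end Loops

/-! ### Removing leaves -/

open Cmd in
/-- Removes the leaf `x`, whose address is in register `15`, and goes on with its neighbor. -/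
def leafStep : Cmd := block
  -- At a leaf the out-degree is the direction of its arc and the neighbor sum is the address of its
  -- neighbor. Both fields stay unchanged and serve as the stack entry.
  [add 20 15 1, load 17 20, add 20 15 2, load 18 20,
    store 15 0,
    load 19 18, sub 19 19 1, store 18 19,
    add 20 18 2, load 19 20, sub 19 19 15, store 20 19,
    add 20 18 1, load 19 20, sub 21 1 17, sub 19 19 21, store 20 19,
    add 20 15 6, store 20 26, add 26 15 0,
    add 20 15 3, load 19 20, add 20 18 3, load 21 20,
    ite 17 (block [add 19 19 11, sub 19 9 19])
      (block [add 27 21 11, add 19 27 19, sub 21 19 10, sub 19 19 21, store 20 19, add 19 27 0]),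
    add 20 15 5, store 20 19, add 15 18 0]

open Cmd in
/-- Removes the current vertex if it is a leaf, and otherwise takes the next vertex of the table. -/
def peelStep : Cmd := block
  [load 17 15, sub 18 17 1, sub 19 1 17, add 18 18 19,
    ite 18 leafStep (block [sub 16 13 14, add 15 14 0, add 14 14 7])]

section Loops

variable {n k B W sgn d : ℕ}

theorem Fits.fld_le {m : ℕ} (hW : Fits n k m B W) {v f : ℕ} (hv : v ≤ n) (hf : f < 8) :
    fld B v f ≤ W := by
  have := hW.1
  simp only [fld]
  omega

/-- The situation when leaves are removed: the arcs in `F` are left, `K` lists the removed leaves,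
`x` is the current vertex, and the vertices from `c` on have not been looked at. -/
structure PeelData (n k B sgn d : ℕ) (E F : Multiset (ℕ × ℕ)) (K : List (ℕ × ℕ × Bool))
    (x c : ℕ) (s : Store) : Prop where
  consts : Consts n k B sgn d s
  arcs : F + stackArcs K = E
  current : s.reg 15 = fld B x 0
  next : s.reg 14 = fld B c 0
  -- Register 16 becomes zero at the end of the scan. Until then, among the vertices already
  -- scanned, only the current one may be a leaf.
  scanned : s.reg 16 = 0 ∧ (∀ v, degree F v ≠ 1) ∨
      s.reg 16 ≠ 0 ∧ c ≤ n ∧ ∀ v < c, v ≠ x → degree F v ≠ 1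
  stack : IsStack k B s.mem (s.reg 26) K
  removed : ∀ e ∈ K, degree F e.1 = 0
  -- Fields 1 and 2 are meaningful as sums only while arcs are left at `v`. Field 3 is stored
  -- without its summand `min 1 k`, so that zeroed memory represents the initial layout data.
  records : ∀ v, s.mem (fld B v 0) = degree F v ∧
      (degree F v ≠ 0 → s.mem (fld B v 1) = outDegree F v ∧
        s.mem (fld B v 2) = neighborSum (fun u => fld B u 0) F v) ∧
      s.mem (fld B v 3) + min 1 k = stackAcc k K v ∧ s.mem (fld B v 4) = 0

/-- The invariant of the loop that removes leaves. -/
def PeelInv (n k B sgn d : ℕ) (E : Multiset (ℕ × ℕ)) (i : ℕ) (s : Store) : Prop :=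
  ∃ F K x c, F.card + (n + 1 - c) = i ∧ PeelData n k B sgn d E F K x c s

/-- A removed leaf has degree zero among the remaining arcs, so it is no end of the arc at hand. -/
theorem PeelData.ne {E F' : Multiset (ℕ × ℕ)} {K : List (ℕ × ℕ × Bool)} {x w c : ℕ} {b : Bool}
    {s : Store} (h : PeelData n k B sgn d E (leafArc x w b ::ₘ F') K x c s) :
    ∀ e ∈ K, e.1 ≠ x ∧ e.1 ≠ w := by
  intro e he
  have h0 := degree_eq_zero.1 (h.removed e he) _ (Multiset.mem_cons_self _ _)
  cases b
  · exact ⟨h0.2.symm, h0.1.symm⟩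
  · exact ⟨h0.1.symm, h0.2.symm⟩

theorem degree_leafArc {F' : Multiset (ℕ × ℕ)} {x w v : ℕ} {b : Bool} {f : ℕ → ℕ} (h₁ : v ≠ x)
    (h₂ : v ≠ w) : degree (leafArc x w b ::ₘ F') v = degree F' v ∧
      outDegree (leafArc x w b ::ₘ F') v = outDegree F' v ∧
      neighborSum f (leafArc x w b ::ₘ F') v = neighborSum f F' v := by
  cases b <;> simp [leafArc, degree_cons, outDegree_cons, neighborSum_cons, h₁.symm, h₂.symm]

/-- The removal of a leaf, given the new contents of registers and memory. -/
theorem PeelData.remove {E F' : Multiset (ℕ × ℕ)} {K : List (ℕ × ℕ × Bool)} {x w c : ℕ} {b : Bool}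
    {s s' : Store} (h : PeelData n k B sgn d E (leafArc x w b ::ₘ F') K x c s)
    (h16 : s.reg 16 ≠ 0) (hwx : w ≠ x) (hF' : ∀ e ∈ F', e.1 ≠ x ∧ e.2 ≠ x)
    (hconsts : Consts n k B sgn d s') (h14 : s'.reg 14 = s.reg 14) (h15 : s'.reg 15 = fld B w 0)
    (h16' : s'.reg 16 = s.reg 16) (h26 : s'.reg 26 = fld B x 0)
    (hother : ∀ v, v ≠ x → v ≠ w → ∀ f < 8, s'.mem (fld B v f) = s.mem (fld B v f))
    (hx₀ : s'.mem (fld B x 0) = 0) (hx₁ : s'.mem (fld B x 1) = b.toNat)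
    (hx₂ : s'.mem (fld B x 2) = fld B w 0) (hx₃ : s'.mem (fld B x 3) = s.mem (fld B x 3))
    (hx₄ : s'.mem (fld B x 4) = s.mem (fld B x 4))
    (hx₅ : s'.mem (fld B x 5) = if b then stackAcc k K w else k - stackAcc k K x)
    (hx₆ : s'.mem (fld B x 6) = s.reg 26)
    (hw₀ : s'.mem (fld B w 0) = degree F' w) (hw₁ : s'.mem (fld B w 1) = outDegree F' w)
    (hw₂ : s'.mem (fld B w 2) = neighborSum (fun u => fld B u 0) F' w)
    (hw₃ : s'.mem (fld B w 3) + min 1 k = stackAcc k ((x, w, b) :: K) w)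
    (hw₄ : s'.mem (fld B w 4) = s.mem (fld B w 4)) :
    PeelData n k B sgn d E F' ((x, w, b) :: K) w c s' := by
  have dx : degree F' x = 0 := degree_eq_zero.2 hF'
  have hacc : ∀ v, v ≠ w → stackAcc k ((x, w, b) :: K) v = stackAcc k K v := fun v hv => by
    cases b
    · rfl
    · simp [stackAcc, hv]
  refine ⟨hconsts, ?_, h15, h14.trans h.next, Or.inr ?_, ?_, ?_, ?_⟩
  · rw [← h.arcs, stackArcs_cons, Multiset.cons_add, Multiset.add_cons]
  · rw [h16']
    obtain ⟨-, hc, hscan⟩ := h.scanned.resolve_left fun h => h16 h.1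
    refine ⟨h16, hc, fun v hv hvw => ?_⟩
    by_cases hvx : v = x
    · rw [hvx, dx]; exact Nat.zero_ne_one
    · rw [← (degree_leafArc (f := id) hvx hvw).1]; exact hscan v hv hvx
  · refine ⟨h26, hx₁, hx₂, hx₅, ?_, hwx, h.ne⟩
    rw [hx₆]
    exact IsStack.congr (fun e he f hf => hother _ (h.ne e he).1 (h.ne e he).2 f hf) h.stack
  · intro e he
    rcases List.mem_cons.1 he with rfl | he
    · exact dx
    · rw [← (degree_leafArc (f := id) (h.ne e he).1 (h.ne e he).2).1]; exact h.removed e he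
  · intro v
    have hv := h.records v
    by_cases hvx : v = x
    · subst hvx
      rw [hx₀, dx, hx₃, hx₄, hacc v hwx.symm]
      exact ⟨rfl, fun h => (h rfl).elim, hv.2.2⟩
    · by_cases hvw : v = w
      · subst hvw
        exact ⟨hw₀, fun _ => ⟨hw₁, hw₂⟩, hw₃, hw₄.trans hv.2.2.2⟩
      · rw [hother v hvx hvw 0 (by omega), hother v hvx hvw 1 (by omega),
          hother v hvx hvw 2 (by omega), hother v hvx hvw 3 (by omega),
          hother v hvx hvw 4 (by omega), hacc v hvw]
        obtain ⟨e1, e2, e3⟩ := degree_leafArc (F' := F') (b := b) (f := fun u => fld B u 0) hvx hvw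
        rw [e1, e2, e3] at hv
        exact hv

theorem peelStep_of_leaf {E F' : Multiset (ℕ × ℕ)} {K : List (ℕ × ℕ × Bool)} {x w c m : ℕ}
    {b : Bool} {s : Store} (hW : Fits n k m B W)
    (h : PeelData n k B sgn d E (leafArc x w b ::ₘ F') K x c s)
    (h16 : s.reg 16 ≠ 0) (hwx : w ≠ x) (hF' : ∀ e ∈ F', e.1 ≠ x ∧ e.2 ≠ x) (hx : x ≤ n)
    (hw : w ≤ n) :
    peelStep.wp W (PeelData n k B sgn d E F' ((x, w, b) :: K) w c) s := by
  have hrem := fun s' => h.remove (s' := s') h16 hwx hF'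
  obtain ⟨c0, c1, c2, c3, c4, c5, c6, c7, c9, c10, c11, c12, c13, c24, c25⟩ := h.consts
  have dx : degree F' x = 0 := degree_eq_zero.2 hF'
  have ox : outDegree F' x = 0 := outDegree_eq_zero fun e he => (hF' e he).1
  have nx : neighborSum (fun u => fld B u 0) F' x = 0 := neighborSum_eq_zero hF'
  have h15 := h.current
  obtain ⟨x0, x1, x3, x4⟩ := h.records x
  obtain ⟨w0, w1, w3, w4⟩ := h.records w
  have ax := stackAcc_le k K x
  have aw := stackAcc_le k K w
  have hk := hW.2.1
  have hfw := fun f => hW.fld_le hw (f := f)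
  have hfx := fun f => hW.fld_le hx (f := f)
  have hb1 : s.mem (fld B x 3) + min 1 k ≤ W := by omega
  have hb2 : s.mem (fld B w 3) + min 1 k ≤ W := by omega
  have hb3 : s.mem (fld B w 3) + min 1 k + s.mem (fld B x 3) ≤ W := by omega
  -- The program computes a minimum by truncated subtraction, as a - (a - b) = min a b; the cap on
  -- the stored word is `k - min 1 k`.
  have hcap : stackAcc k K w + s.mem (fld B x 3) -
      (stackAcc k K w + s.mem (fld B x 3) - (k - min 1 k)) + min 1 k =
      min k (stackAcc k K w + stackAcc k K x) := by omega
  clear h hW hk ax aw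
  cases b
  all_goals
    simp [leafArc, degree_cons, outDegree_cons, neighborSum_cons, dx, ox, nx, hwx, hwx.symm]
      at x0 x1 w0 w1
    rw [Nat.add_comm (fld B x 0)] at w1
    obtain ⟨x1, x2⟩ := x1
    obtain ⟨w1, w2⟩ := w1
    simp [peelStep, leafStep, Cmd.block, Cmd.wp, Store.setReg, Store.setMem,
        c0, c1, c2, c3, c5, c6, c9, c10, c11, h15, x0, x1, x2, w0, w1, w2, hwx, hwx.symm,
        fld_add, fld_inj, hfw, hfx, hb1, hb2, hb3]
    apply hrem
  all_goals clear hrem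
  all_goals
    simp [Consts, Function.update_apply, fld_inj, hwx.symm, stackAcc, *]
  all_goals
    intro v hvx hvw f hf
    simp [fld_inj, hf, hvx, hvw]

theorem peelStep_of_not_leaf {E F : Multiset (ℕ × ℕ)} {K : List (ℕ × ℕ × Bool)} {x c m : ℕ}
    {s : Store} (hW : Fits n k m B W) (hF : ∀ e ∈ F, e.1 < n ∧ e.2 < n)
    (hm : F.card ≤ m)
    (h : PeelData n k B sgn d E F K x c s) (h16 : s.reg 16 ≠ 0) (hx : degree F x ≠ 1) :
    peelStep.wp W (fun s' => c ≤ n ∧ PeelData n k B sgn d E F K c (c + 1) s') s := by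
  obtain ⟨c0, c1, c2, c3, c4, c5, c6, c7, c9, c10, c11, c12, c13, c24, c25⟩ := h.consts
  have h15 := h.current
  have h14 := h.next
  obtain ⟨-, hc, hscan⟩ := h.scanned.resolve_left fun h => h16 h.1
  have hscan' : ∀ v < c, degree F v ≠ 1 := fun v hv => by
    by_cases hvx : v = x
    · rwa [hvx]
    · exact hscan v hv hvx
  have x0 := (h.records x).1
  have hc1 : fld B c 0 + 8 = fld B (c + 1) 0 := by simp only [fld]; omega
  have hb1 : fld B (c + 1) 0 ≤ W := by have := hW.1; simp only [fld]; omega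
  have hb2 : fld B c 0 ≤ W := hW.fld_le hc (by omega)
  have hne : ¬ (degree F x - 1 = 0 ∧ 1 - degree F x = 0) := by omega
  have hbd : degree F x - 1 + (1 - degree F x) ≤ W := by
    have := degree_le (F := F) x
    have := hW.2.2.2.1
    have := hW.1
    omega
  simp only [peelStep, Cmd.block, Cmd.wp, Store.setReg]
  simp [c0, c1, c7, c13, h15, h14, x0, hc1, hbd, hb1, hb2, hc]
  refine ⟨fun h1 h2 => (hne ⟨h1, h2⟩).elim, fun _ => ⟨?_, h.arcs, by simp, by simp, ?_, ?_,
    h.removed, h.records⟩⟩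
  · simp [Consts, *]
  -- For `c = n` the whole table has been scanned, and vertices from `n` on have no arcs; so no leaf
  -- is left and register 16 gets the value zero.
  · rcases Nat.lt_or_ge c n with hcn | hcn
    · refine Or.inr ⟨?_, by omega, fun v hv hvc => hscan' v (by omega)⟩
      simp [fld]
      omega
    · refine Or.inl ⟨?_, fun v => ?_⟩
      · simp [fld]
        omega
      · rcases Nat.lt_or_ge v c with hv | hv
        · exact hscan' v hv
        · rw [degree_eq_zero.2 fun e he => by have := hF e he; omega]
          exact Nat.zero_ne_one
  · simpa using h.stack

/-- Each round either removes an arc or advances the scan, so the number of remaining arcs plus `n +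
1 - c` drops. -/
theorem peelStep_spec {E : Multiset (ℕ × ℕ)} (hW : Fits n k E.card B W)
    (hn : ∀ e ∈ E, e.1 < n ∧ e.2 < n)
    (i : ℕ) (s : Store) (h : PeelInv n k B sgn d E i s) (h16 : s.reg 16 ≠ 0) :
    peelStep.wp W (fun s' => ∃ j < i, PeelInv n k B sgn d E j s') s := by
  obtain ⟨F, K, x, c, hi, h⟩ := h
  have hF : ∀ e ∈ F, e.1 < n ∧ e.2 < n := fun e he =>
    hn e (by rw [← h.arcs]; exact Multiset.mem_add.2 (Or.inl he))
  by_cases hx : degree F x = 1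
  · obtain ⟨w, b, F', rfl, hwx, hF'⟩ := exists_leafArc hx
    have hxw : x < n ∧ w < n := by
      have h0 := hF _ (Multiset.mem_cons_self _ _)
      cases b
      · exact h0.symm
      · exact h0
    rw [Multiset.card_cons] at hi
    exact Cmd.wp_mono (peelStep_of_leaf hW h h16 hwx hF' hxw.1.le hxw.2.le) fun s' hs' =>
      ⟨i - 1, by omega, F', _, w, c, by omega, hs'⟩
  · have hm : F.card ≤ E.card := by rw [← h.arcs, Multiset.card_add]; omega
    exact Cmd.wp_mono (peelStep_of_not_leaf hW hF hm h h16 hx) fun s' hs' =>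
      ⟨i - 1, by omega, F, K, c, c + 1, by omega, hs'.2⟩

end Loops

/-! ### Placing the leaves in reverse order -/

open Cmd in
/-- Places the topmost leaf of the stack, whose address is in register `26`. -/
def placeStep : Cmd := block
  [add 20 26 2, load 18 20, add 20 26 1, load 17 20, add 20 26 5, load 19 20,
    add 20 18 4, load 21 20, add 21 21 19, sub 20 21 10, ite 20 skip (sub 21 21 9),
    add 20 26 4, store 20 21,
    ite 17
      (block [add 20 18 3, load 19 20, add 20 26 3, load 21 20, add 21 21 19, add 21 21 11,
        sub 19 21 10, sub 21 21 19, store 20 21])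
      skip,
    add 20 26 6, load 26 20]

section Loops

variable {n k B W sgn d : ℕ}

/-- The situation when the leaves in `K` are still to be placed. -/
structure PlaceData (n k B sgn d : ℕ) (E : Multiset (ℕ × ℕ)) (K : List (ℕ × ℕ × Bool))
    (P : Multiset (ℕ × ℕ)) (s : Store) : Prop where
  consts : Consts n k B sgn d s
  arcs : P + stackArcs K = E
  stack : IsStack k B s.mem (s.reg 26) K
  placed : ∀ e ∈ K, ∀ a ∈ P, a.1 ≠ e.1 ∧ a.2 ≠ e.1
  size_le : ∀ v, s.mem (fld B v 3) + min 1 k ≤ k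
  start_le : ∀ v, s.mem (fld B v 4) ≤ k - 1
  layout : IsLayout k (fun u v => (u, v) ∈ P) (stackAcc k K) (fun v => s.mem (fld B v 3) + min 1 k)
    fun v => s.mem (fld B v 4)

theorem IsLayout.congr {V : Type*} {k : ℕ} {r : V → V → Prop} {acc q q' s s' : V → ℕ}
    (h : IsLayout k r acc q s) (hq : ∀ v, q v = q' v) (hs : ∀ v, s v = s' v) :
    IsLayout k r acc q' s' := by
  obtain rfl : q = q' := funext hq
  obtain rfl : s = s' := funext hs
  exact h

/-- No placed arc touches `x` yet, so its chain is empty and the stored size is the reserved one. -/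
theorem PlaceData.acc_eq {E : Multiset (ℕ × ℕ)} {x w : ℕ} {b : Bool} {K : List (ℕ × ℕ × Bool)}
    {P : Multiset (ℕ × ℕ)} {s : Store} (h : PlaceData n k B sgn d E ((x, w, b) :: K) P s)
    (hb : b = false) : s.mem (fld B x 3) + min 1 k = stackAcc k K x := by
  subst hb
  obtain ⟨l, -, hl, hc⟩ := h.layout x
  obtain rfl : l = [] := List.eq_nil_iff_forall_not_mem.mpr fun u hu =>
    (h.placed _ (List.mem_cons_self ..) _ ((hl u).1 hu)).2 rfl
  exact hc

/-- Placing a leaf, given the new contents of registers and memory. -/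
theorem PlaceData.place {E : Multiset (ℕ × ℕ)} {x w : ℕ} {b : Bool} {K : List (ℕ × ℕ × Bool)}
    {P : Multiset (ℕ × ℕ)} {s s' : Store} (h : PlaceData n k B sgn d E ((x, w, b) :: K) P s)
    (hconsts : Consts n k B sgn d s') (h26 : s'.reg 26 = s.mem (fld B x 6))
    (hother : ∀ v, v ≠ x → ∀ f < 8, s'.mem (fld B v f) = s.mem (fld B v f))
    (h3 : s'.mem (fld B x 3) + min 1 k = if b then s.mem (fld B x 3) + min 1 k else
      min k (s.mem (fld B x 3) + min 1 k + (s.mem (fld B w 3) + min 1 k)))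
    (h4 : s'.mem (fld B x 4) = (s.mem (fld B w 4) + s.mem (fld B x 5)) % k) :
    PlaceData n k B sgn d E K (leafArc x w b ::ₘ P) s' := by
  have hlay := h.layout
  have hacc := h.acc_eq
  have hplaced := h.placed
  obtain ⟨h26', -, -, h5, hst, hwx, hne⟩ := h.stack
  have hP : ∀ a ∈ P, a.1 ≠ x ∧ a.2 ≠ x := hplaced (x, w, b) (List.mem_cons_self ..)
  have hbound : (s.mem (fld B w 4) + s.mem (fld B x 5)) % k ≤ k - 1 := by
    rcases Nat.eq_zero_or_pos k with rfl | hk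
    · have h1 := h.start_le w
      rw [h5]
      have h2 := stackAcc_le 0 K w
      rw [Nat.mod_zero]
      cases b <;> simp <;> omega
    · have := Nat.mod_lt (s.mem (fld B w 4) + s.mem (fld B x 5)) hk
      omega
  refine ⟨hconsts, ?_, ?_, ?_, ?_, ?_, ?_⟩
  · rw [← h.arcs, stackArcs_cons, Multiset.cons_add, Multiset.add_cons]
  · rw [h26]
    exact IsStack.congr (fun e he f hf => hother _ (hne e he).1 f hf) hst
  · intro e he a ha
    rcases Multiset.mem_cons.1 ha with rfl | ha
    · have := hne e he
      cases b
      · exact ⟨this.2.symm, this.1.symm⟩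
      · exact ⟨this.1.symm, this.2.symm⟩
    · exact hplaced e (List.mem_cons_of_mem _ he) a ha
  · intro v
    by_cases hv : v = x
    · rw [hv, h3]
      split_ifs
      · exact h.size_le x
      · exact min_le_left _ _
    · rw [hother v hv 3 (by omega)]
      exact h.size_le v
  · intro v
    by_cases hv : v = x
    · rw [hv, h4]
      exact hbound
    · rw [hother v hv 4 (by omega)]
      exact h.start_le v
  · cases b
    · have hsw : s.mem (fld B w 4) % k = s.mem (fld B w 4) := by
        have := h.start_le w
        rcases Nat.eq_zero_or_pos k with rfl | hk
        · rw [Nat.mod_zero]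
        · exact Nat.mod_eq_of_lt (by omega)
      refine (IsLayout.extend_head (x := x) (w := w) hwx hP (stackAcc_le k K x) hsw hlay).congr
        (fun v => ?_) (fun v => ?_)
      · by_cases hv : v = x
        · subst hv
          rw [Function.update_self, h3]
          rfl
        · rw [Function.update_of_ne hv, hother v hv 3 (by omega)]
      · by_cases hv : v = x
        · subst hv
          rw [Function.update_self, h4, h5]
          rfl
        · rw [Function.update_of_ne hv, hother v hv 4 (by omega)]
    · refine (IsLayout.extend_tail (x := x) (w := w) hwx hP hlay).congr
        (fun v => ?_) (fun v => ?_)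
      · by_cases hv : v = x
        · subst hv
          exact h3.symm
        · rw [hother v hv 3 (by omega)]
      · by_cases hv : v = x
        · subst hv
          rw [Function.update_self, h4, h5]
          rfl
        · rw [Function.update_of_ne hv, hother v hv 4 (by omega)]

/-- The invariant of the loop that places the leaves. -/
def PlaceInv (n k B sgn d : ℕ) (E : Multiset (ℕ × ℕ)) (i : ℕ) (s : Store) : Prop :=
  ∃ K P, K.length = i ∧ PlaceData n k B sgn d E K P s

theorem placeStep_spec {E : Multiset (ℕ × ℕ)} {m : ℕ} (hW : Fits n k m B W)
    (hn : ∀ e ∈ E, e.1 < n ∧ e.2 < n)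
    (i : ℕ) (s : Store) (h : PlaceInv n k B sgn d E i s) (h26 : s.reg 26 ≠ 0) :
    placeStep.wp W (fun s' => ∃ j < i, PlaceInv n k B sgn d E j s') s := by
  obtain ⟨K, P, hi, h⟩ := h
  obtain - | ⟨⟨x, w, b⟩, K⟩ := K
  · exact (h26 h.stack).elim
  have hxw : x < n ∧ w < n := by
    have h0 := hn (leafArc x w b) (by
      rw [← h.arcs, stackArcs_cons]
      exact Multiset.mem_add.2 (Or.inr (Multiset.mem_cons_self _ _)))
    cases b
    · exact h0.symm
    · exact h0
  refine Cmd.wp_mono (Q := PlaceData n k B sgn d E K (leafArc x w b ::ₘ P)) ?_ fun s' hs' =>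
    ⟨i - 1, ?_, K, _, ?_, hs'⟩
  rotate_left
  · simp only [List.length_cons] at hi; omega
  · simp only [List.length_cons] at hi; omega
  have hpl := fun s' => h.place (s' := s')
  obtain ⟨c0, c1, c2, c3, c4, c5, c6, c7, c9, c10, c11, c12, c13, c24, c25⟩ := h.consts
  obtain ⟨e26, e1, e2, e5, -, hwx, -⟩ := h.stack
  have hk := hW.2.1
  have hfw := fun f => hW.fld_le hxw.2.le (f := f)
  have hfx := fun f => hW.fld_le hxw.1.le (f := f)
  have hax := h.size_le x
  have haw := h.size_le w
  have hsw := h.start_le w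
  have h5 : s.mem (fld B x 5) ≤ k := by
    rw [e5]
    have := stackAcc_le k K w
    split_ifs <;> omega
  have hb1 : s.mem (fld B w 4) + s.mem (fld B x 5) ≤ W := by omega
  have hb2 : s.mem (fld B x 3) + s.mem (fld B w 3) ≤ W := by omega
  have hb3 : s.mem (fld B x 3) + s.mem (fld B w 3) + min 1 k ≤ W := by omega
  -- A place is at most `k - 1` and an offset at most `k`, so a single conditional subtraction of
  -- `k` reduces the sum modulo `k`. For `k = 0` all these words vanish.
  have hmod1 : s.mem (fld B w 4) + s.mem (fld B x 5) ≤ k - min 1 k →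
      s.mem (fld B w 4) + s.mem (fld B x 5) = (s.mem (fld B w 4) + s.mem (fld B x 5)) % k := by
    intro h
    rcases Nat.eq_zero_or_pos k with rfl | hk
    · rw [Nat.mod_zero]
    · exact (Nat.mod_eq_of_lt (by omega)).symm
  have hmod2 : k - min 1 k < s.mem (fld B w 4) + s.mem (fld B x 5) →
      s.mem (fld B w 4) + s.mem (fld B x 5) - k =
        (s.mem (fld B w 4) + s.mem (fld B x 5)) % k := by
    intro h
    rcases Nat.eq_zero_or_pos k with rfl | hk
    · rw [Nat.mod_zero, Nat.sub_zero]
    · rw [Nat.mod_eq_sub_mod (by omega), Nat.mod_eq_of_lt (by omega)]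
  have hcap : s.mem (fld B x 3) + s.mem (fld B w 3) + min 1 k -
      (s.mem (fld B x 3) + s.mem (fld B w 3) + min 1 k - (k - min 1 k)) + min 1 k =
      min k (s.mem (fld B x 3) + min 1 k + (s.mem (fld B w 3) + min 1 k)) := by omega
  clear h hW hk e5
  cases b
  all_goals
    simp at e1
    simp [placeStep, Cmd.block, Cmd.wp, Store.setReg, Store.setMem, Nat.sub_eq_zero_iff_le,
        c1, c2, c3, c4, c5, c6, c9, c10, c11, e26, e1, e2, hwx,
        fld_add, fld_inj, hfw, hfx, hb1, hb2, hb3]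
    refine ⟨fun hc => hpl _ ?_ ?_ ?_ ?_ ?_, fun hc => hpl _ ?_ ?_ ?_ ?_ ?_⟩
  all_goals clear hpl
  all_goals first
    | (intro v hv f hf; simp [fld_inj, hf, hv])
    | (simp [fld_inj]; done)
    | (simp [fld_inj, hcap]; done)
    | simpa [fld_inj] using hmod1 hc
    | simpa [fld_inj] using hmod2 hc
    | (simp [Consts, c0, c1, c2, c3, c4, c5, c6, c7, c9, c10, c11, c12, c13, c24, c25])

end Loops

/-! ### Summation and output -/

open Cmd in
/-- Adds the dissatisfaction with one item to register `28` and writes the label of the item. -/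
def emitStep : Cmd := block
  [add 20 14 3, load 19 20, sub 19 10 19, add 28 28 19, add 20 14 4, load 19 20, add 19 19 11,
    store 27 19, add 27 27 1, add 14 14 7, sub 16 13 14]

section Loops

variable {n k B W sgn d : ℕ}

/-- The invariant of the output loop, when `i` items are left; `q` and `l` are the contents of the
fields 3 and 4 of the records. -/
def EmitInv (n k B sgn d : ℕ) (q l : ℕ → ℕ) (i : ℕ) (s : Store) : Prop :=
  Consts n k B sgn d s ∧ ∃ c, c + i = n ∧ s.reg 14 = fld B c 0 ∧ s.reg 27 = c + 1 ∧
    s.reg 16 = fld B n 0 - fld B c 0 ∧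
    s.reg 28 = ∑ v ∈ Finset.range c, (k - min 1 k - q v) ∧
    (∀ v, s.mem (fld B v 3) = q v ∧ s.mem (fld B v 4) = l v) ∧
    ∀ v < c, s.mem (v + 1) = l v + min 1 k

theorem sum_range_le (n k : ℕ) (q : ℕ → ℕ) :
    ∑ v ∈ Finset.range n, (k - min 1 k - q v) ≤ n * k := by
  have : ∀ v ∈ Finset.range n, k - min 1 k - q v ≤ k := fun v _ => by omega
  simpa using Finset.sum_le_card_nsmul _ _ _ this

theorem emitStep_spec {m : ℕ} {q l : ℕ → ℕ} (hW : Fits n k m B W) (hB : n < B)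
    (hl : ∀ v, l v + min 1 k ≤ k) (i : ℕ) (s : Store) (h : EmitInv n k B sgn d q l i s)
    (h16 : s.reg 16 ≠ 0) :
    emitStep.wp W (fun s' => ∃ j < i, EmitInv n k B sgn d q l j s') s := by
  obtain ⟨⟨c0, c1, c2, c3, c4, c5, c6, c7, c9, c10, c11, c12, c13, c24, c25⟩, c, hci, h14, h27,
    hf, h28, hrec, hout⟩ := h
  have hcn : c < n := by
    by_contra hc
    obtain rfl : c = n := by omega
    exact h16 (by rw [hf, Nat.sub_self])
  have r3 := fun v => (hrec v).1
  have r4 := fun v => (hrec v).2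
  have hfc := fun f => hW.fld_le hcn.le (f := f)
  have hc1 : fld B c 0 + 8 = fld B (c + 1) 0 := by simp only [fld]; omega
  have hb1 : fld B (c + 1) 0 ≤ W := hW.fld_le hcn (by omega)
  have hlc := hl c
  have hk := hW.2.1
  have hb2 : l c + min 1 k ≤ W := by omega
  have hb3 : ∑ v ∈ Finset.range c, (k - min 1 k - q v) + (k - min 1 k - q c) ≤ W := by
    rw [← Finset.sum_range_succ (fun v => k - min 1 k - q v)]
    have := sum_range_le (c + 1) k q
    have := Nat.mul_le_mul_right k (show c + 1 ≤ n from hcn)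
    have := hW.2.2.2.2
    omega
  have hb4 : c + 1 + 1 ≤ W := by have := hW.1; omega
  -- The labels go to cells at most `n`, below the table; they may overwrite input that is no longer
  -- needed.
  have hne : ∀ v f, fld B v f ≠ c + 1 := fun v f => (fld_ne_of_lt (by omega) v f).symm
  simp [emitStep, Cmd.block, Cmd.wp, Store.setReg, Store.setMem,
    c1, c3, c4, c7, c10, c11, c13, h14, h27, h28, r3, r4, fld_add, hc1, hfc, hb1, hb2, hb3, hb4]
  refine ⟨i - 1, by omega, ?_, c + 1, by omega, ?_, ?_, ?_, ?_, ?_, ?_⟩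
  · simp [Consts, c0, c1, c2, c3, c4, c5, c6, c7, c9, c10, c11, c12, c13, c24, c25]
  · simp
  · simp
  · simp
  · simp [Finset.sum_range_succ]
  · intro v
    simp [hne, r3, r4]
  · intro v hv
    rcases Nat.lt_succ_iff_lt_or_eq.1 hv with hv | rfl
    · simp [hv.ne, hout v hv]
    · simp

/-- This choice of `B` puts the table behind the input, of `5 + 2 * arcs.length` cells, and behind
the output cells `0, …, n`, in memory that is still zero. -/
theorem ArcInv.of_setup {arcs : List (ℕ × ℕ)} {mem₀ : ℕ → ℕ}
    (hB : B = arcs.length + arcs.length + n + 5) (hW : Fits n k arcs.length B W)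
    (h0 : mem₀ 0 = n) (h1 : mem₀ 1 = k) (h2 : mem₀ 2 = sgn) (h3 : mem₀ 3 = d)
    (h4 : mem₀ 4 = arcs.length) (hbig : ∀ a, B ≤ a → mem₀ a = 0) :
    setup.wp W (ArcInv n k B sgn d arcs mem₀ arcs.length) ⟨fun _ => 0, mem₀⟩ := by
  have w1 := hW.1
  have w2 := hW.2.1
  have hBW : arcs.length + arcs.length + n + 5 ≤ W := by omega
  have hnW : n + n + (n + n) + (n + n + (n + n)) ≤ W := by omega
  have hfn := hW.fld_le le_rfl (f := 0)
  have hmin' : 1 - (1 - k) = min 1 k := by omega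
  simp [setup, Cmd.block, Cmd.wp, Store.setReg, h0, h1, h2, h3, h4, ← hB, hmin',
    eight_mul_add, hnW]
  refine ⟨by omega, by omega, by omega, by omega, by omega, by omega, by omega, by omega, by omega,
    by omega, by omega, by omega, by omega, hfn (by omega), by omega, ?_, 0, 0, by simp, by simp,
    by simp, ?_, by simp, by simp, fun v => ?_⟩
  · simp [Consts]
  · simp
    omega
  · have hz : ∀ f, mem₀ (fld B v f) = 0 := fun f => hbig _ (by simp only [fld]; omega)
    simp [hz, degree, outDegree, neighborSum]

/-- Starts the removal of leaves. -/
def startPeel : Cmd := Cmd.block [.const 16 1, .const 26 0, .add 14 12 0, .add 15 13 0]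

/-- Starts the output. -/
def startEmit : Cmd := Cmd.block [.const 28 0, .const 27 1, .add 14 12 0, .sub 16 13 12]

/-- Writes the answer. -/
def answer : Cmd := Cmd.block [.sub 17 28 25, .add 17 17 24, .sub 17 1 17, .store 0 17]

theorem startPeel_spec {arcs : List (ℕ × ℕ)} {mem₀ : ℕ → ℕ} {i : ℕ} {s : Store}
    (hW : Fits n k arcs.length B W) (h : ArcInv n k B sgn d arcs mem₀ i s) (h16 : s.reg 16 = 0) :
    startPeel.wp W (PeelInv n k B sgn d arcs (arcs.length + (n + 1))) s := by
  obtain ⟨⟨c0, c1, c2, c3, c4, c5, c6, c7, c9, c10, c11, c12, c13, c24, c25⟩, j, F, hji, hF, h22,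
    h23, hf, -, hrec⟩ := h
  obtain rfl : j = arcs.length := by omega
  rw [List.drop_length, Multiset.coe_nil, Multiset.add_zero] at hF
  subst hF
  have hW1 := hW.1
  have hfn := hW.fld_le le_rfl (show 0 < 8 by omega)
  have hB0 : B = fld B 0 0 := rfl
  simp [startPeel, Cmd.block, Cmd.wp, Store.setReg, c0, c12, c13, hfn]
  -- The scan starts with the dummy current vertex `n`, just past the items, and with nothing
  -- scanned.
  refine ⟨by omega, by omega, arcs, [], n, 0, by simp, ?_, by simp [stackArcs], by simp,
    by simp [fld], Or.inr (by simp), by simp [IsStack], by simp, fun v => ?_⟩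
  · simp [Consts, c0, c1, c2, c3, c4, c5, c6, c7, c9, c10, c11, c12, c13, c24, c25]
  · obtain ⟨e0, e1, e2, e3, e4⟩ := hrec v
    exact ⟨e0, fun _ => ⟨e1, e2⟩, by simp [e3, stackAcc], e4⟩

/-- When no leaf is left, all arcs of a forest have been removed. -/
theorem PeelInv.place {E : Multiset (ℕ × ℕ)} {i : ℕ} {s : Store} (hE : HasLeaves E)
    (h : PeelInv n k B sgn d E i s) (h16 : s.reg 16 = 0) :
    PlaceInv n k B sgn d E E.card s := by
  obtain ⟨F, K, x, c, -, h⟩ := h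
  obtain ⟨-, hF⟩ := h.scanned.resolve_right fun h' => h'.1 h16
  obtain rfl : F = 0 := by
    by_contra hF0
    obtain ⟨v, hv⟩ := hE F (by rw [← h.arcs]; exact Multiset.le_add_right _ _) hF0
    exact hF v hv
  -- Before any arc is placed, all places are 0, all chains are empty, and sizes equal the reserved
  -- numbers.
  refine ⟨K, 0, ?_, h.consts, h.arcs, h.stack, by simp, fun v => ?_, fun v => ?_, fun v => ?_⟩
  · rw [← h.arcs]
    simp [stackArcs]
  · rw [(h.records v).2.2.1]
    exact stackAcc_le k K v
  · rw [(h.records v).2.2.2]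
    exact Nat.zero_le _
  · exact ⟨[], List.nodup_nil, by simp, (h.records v).2.2.1⟩

theorem startEmit_spec {E : Multiset (ℕ × ℕ)} {i m : ℕ} {s : Store} (hW : Fits n k m B W)
    (hB : 0 < B) (h : PlaceInv n k B sgn d E i s) (h26 : s.reg 26 = 0) :
    ∃ q l : ℕ → ℕ, IsLayout k (fun u v => (u, v) ∈ E) (fun _ => min 1 k) (fun v => q v + min 1 k) l ∧
      (∀ v, l v ≤ k - 1) ∧ startEmit.wp W (EmitInv n k B sgn d q l n) s := by
  obtain ⟨K, P, -, h⟩ := h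
  obtain rfl : K = [] := by
    obtain - | ⟨⟨x, w, b⟩, K⟩ := K
    · rfl
    -- Record addresses are at least `B > 0`, so a zero link can only mean the empty stack.
    · have := h.stack.1
      rw [h26] at this
      simp only [fld] at this
      omega
  obtain rfl : P = E := by simpa [stackArcs] using h.arcs
  refine ⟨fun v => s.mem (fld B v 3), fun v => s.mem (fld B v 4), h.layout, h.start_le, ?_⟩
  obtain ⟨c0, c1, c2, c3, c4, c5, c6, c7, c9, c10, c11, c12, c13, c24, c25⟩ := h.consts
  have hW1 := hW.1
  simp [startEmit, Cmd.block, Cmd.wp, Store.setReg, c0, c12, c13]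
  refine ⟨by omega, by omega, ?_, 0, by simp, by simp [fld], by simp, by simp [fld], by simp,
    by simp, by simp⟩
  simp [Consts, c0, c1, c2, c3, c4, c5, c6, c7, c9, c10, c11, c12, c13, c24, c25]

/-- With truncated subtraction the answer is 1 exactly if the total is at most `d` and the sign word
is 0; a negative bound is never met. -/
theorem answer_spec {i m : ℕ} {q l : ℕ → ℕ} {s : Store} (hW : Fits n k m B W) (hsgn : sgn ≤ 1)
    (h : EmitInv n k B sgn d q l i s) (h16 : s.reg 16 = 0) :
    answer.wp W (fun s' => (∀ v < n, s'.mem (v + 1) = l v + min 1 k) ∧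
      s'.mem 0 = 1 - (∑ v ∈ Finset.range n, (k - (q v + min 1 k)) - d + sgn)) s := by
  obtain ⟨⟨c0, c1, c2, c3, c4, c5, c6, c7, c9, c10, c11, c12, c13, c24, c25⟩, c, hci, h14, h27,
    hf, h28, -, hout⟩ := h
  obtain rfl : c = n := by
    rw [h16] at hf
    simp only [fld] at hf
    omega
  have hsum := sum_range_le c k q
  have hk := hW.2.2.2.2
  have hq : ∀ v, k - (q v + min 1 k) = k - min 1 k - q v := fun v => by omega
  simp [answer, Cmd.block, Cmd.wp, Store.setReg, Store.setMem, c0, c1, c24, c25, h28, hq]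
  exact ⟨by omega, hout⟩

/-! ### The whole program: correctness and running time -/

open Cmd in
/-- The whole program. -/
def mainCmd : Cmd :=
  setup.seq <| (loop 16 arcStep).seq <| startPeel.seq <| (loop 16 peelStep).seq <|
  (loop 26 placeStep).seq <| startEmit.seq <| (loop 16 emitStep).seq answer

theorem mainCmd_spec {arcs : List (ℕ × ℕ)} {mem₀ : ℕ → ℕ}
    (hB : B = arcs.length + arcs.length + n + 5) (hW : Fits n k arcs.length B W)
    (hm : arcs.length ≤ n) (hn : ∀ e ∈ arcs, e.1 < n ∧ e.2 < n ∧ e.1 ≠ e.2)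
    (hleaf : HasLeaves arcs) (hs : ∀ a, mem₀ a ≤ W)
    (h0 : mem₀ 0 = n) (h1 : mem₀ 1 = k) (h2 : mem₀ 2 = sgn) (h3 : mem₀ 3 = d)
    (h4 : mem₀ 4 = arcs.length) (hbig : ∀ a, B ≤ a → mem₀ a = 0)
    (hmem : ∀ j (h : j < arcs.length), mem₀ (5 + 2 * j) = arcs[j].1 ∧
      mem₀ (5 + 2 * j + 1) = arcs[j].2) (hsgn : sgn ≤ 1) :
    Cmd.Reaches W mainCmd (300 * (n + 1)) ⟨fun _ => 0, mem₀⟩ fun s => ∃ q l : ℕ → ℕ,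
      IsLayout k (fun u v => (u, v) ∈ arcs) (fun _ => min 1 k) q l ∧ (∀ v, l v ≤ k - 1) ∧
      (∀ v < n, s.mem (v + 1) = l v + min 1 k) ∧
      s.mem 0 = 1 - (∑ v ∈ Finset.range n, (k - q v) - d + sgn) := by
  have hn' : ∀ e ∈ (arcs : Multiset (ℕ × ℕ)), e.1 < n ∧ e.2 < n := fun e he =>
    ⟨(hn e he).1, (hn e he).2.1⟩
  have hB5 : 5 + 2 * arcs.length ≤ B := by omega
  have hbd : Store.Bounded W ⟨fun _ => 0, mem₀⟩ := ⟨fun _ => Nat.zero_le _, hs⟩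
  have hA := ArcInv.of_setup (k := k) (sgn := sgn) (d := d) hB hW h0 h1 h2 h3 h4 hbig
  have key : Cmd.Reaches W mainCmd (setup.cost + ((arcStep.cost + 2) * arcs.length + 1 +
      (startPeel.cost + ((peelStep.cost + 2) * (arcs.length + (n + 1)) + 1 +
      ((placeStep.cost + 2) * arcs.length + 1 + (startEmit.cost +
      ((emitStep.cost + 2) * n + 1 + answer.cost))))))) ⟨fun _ => 0, mem₀⟩
      fun s => ∃ q l : ℕ → ℕ,
      IsLayout k (fun u v => (u, v) ∈ arcs) (fun _ => min 1 k) q l ∧ (∀ v, l v ≤ k - 1) ∧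
      (∀ v < n, s.mem (v + 1) = l v + min 1 k) ∧
      s.mem 0 = 1 - (∑ v ∈ Finset.range n, (k - q v) - d + sgn) := by
    refine (Cmd.Reaches.of_wp _ hbd hA).seq fun s hs h => ?_
    refine (Cmd.Reaches.loop _ (fun i s hs h h16 => Cmd.Reaches.of_wp _ hs
      (arcStep_spec hW hB5 hn hmem i s h h16)) _ s hs h).seq fun s hs h => ?_
    obtain ⟨h16, i, h⟩ := h
    refine (Cmd.Reaches.of_wp _ hs (startPeel_spec hW h h16)).seq fun s hs h => ?_
    refine (Cmd.Reaches.loop _ (fun i s hs h h16 => Cmd.Reaches.of_wp _ hs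
      (peelStep_spec hW hn' i s h h16)) _ s hs h).seq fun s hs h => ?_
    obtain ⟨h16, i, h⟩ := h
    refine (Cmd.Reaches.loop _ (fun i s hs h h16 => Cmd.Reaches.of_wp _ hs
      (placeStep_spec hW hn' i s h h16)) _ s hs (h.place hleaf h16)).seq fun s hs h => ?_
    obtain ⟨h26, i, h⟩ := h
    obtain ⟨q, l, hlay, hl, h⟩ := startEmit_spec hW (by omega) h h26
    refine (Cmd.Reaches.of_wp _ hs h).seq fun s hs h => ?_
    refine (Cmd.Reaches.loop _ (fun i s hs h h16 => Cmd.Reaches.of_wp _ hs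
      (emitStep_spec hW (by omega) (fun v => by have := hl v; omega) i s h h16))
      _ s hs h).seq fun s hs h => ?_
    obtain ⟨h16, i, h⟩ := h
    exact (Cmd.Reaches.of_wp _ hs (answer_spec hW hsgn h h16)).mono le_rfl fun s' hs' =>
      ⟨_, l, hlay, hl, hs'⟩
  refine key.mono ?_ fun _ h => h
  have t1 : setup.cost ≤ 30 := by decide
  have t2 : arcStep.cost ≤ 40 := by decide
  have t3 : startPeel.cost ≤ 10 := by decide
  have t4 : peelStep.cost ≤ 60 := by decide
  have t5 : placeStep.cost ≤ 40 := by decide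
  have t6 : startEmit.cost ≤ 10 := by decide
  have t7 : emitStep.cost ≤ 20 := by decide
  have t8 : answer.cost ≤ 10 := by decide
  have p2 := Nat.mul_le_mul (Nat.add_le_add_right t2 2) hm
  have p4 := Nat.mul_le_mul (Nat.add_le_add_right t4 2) (Nat.add_le_add_right hm (n + 1))
  have p5 := Nat.mul_le_mul (Nat.add_le_add_right t5 2) hm
  have p7 := Nat.mul_le_mul_right n (Nat.add_le_add_right t7 2)
  omega

end Loops

/-! ### The program solves the problem -/

/-- The program treats vertices as natural numbers; since all tails are below `n`, the in-neighbor
lists lift to `Fin n`. -/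
theorem IsLayout.of_nat {n k : ℕ} {q s acc : ℕ → ℕ} {r : ℕ → ℕ → Prop}
    (hr : ∀ u v, r u v → u < n) (h : IsLayout k r acc q s) :
    IsLayout (V := Fin n) k (fun u v => r u v) (fun v => acc v) (fun v => q v) fun v => s v := by
  intro v
  obtain ⟨l, hnd, hl, hc⟩ := h v
  obtain ⟨l, rfl⟩ : ∃ l' : List (Fin n), l'.map Fin.val = l :=
    ⟨l.pmap Fin.mk fun u hu => hr _ _ ((hl u).1 hu), by simp [List.map_pmap]⟩
  refine ⟨l, hnd.of_map _, fun u => ?_, hc.of_map Fin.val⟩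
  change u ∈ l ↔ r u v
  rw [← hl, List.mem_map_of_injective Fin.val_injective]

theorem length_flatMap_pair (l : List (ℕ × ℕ)) :
    (l.flatMap fun e => [e.1, e.2]).length = 2 * l.length := by
  induction l with
  | nil => rfl
  | cons e l ih => simp [ih, Nat.mul_succ]

theorem getD_flatMap_pair (l : List (ℕ × ℕ)) : ∀ j (h : j < l.length),
    (l.flatMap fun e => [e.1, e.2]).getD (2 * j) 0 = l[j].1 ∧
      (l.flatMap fun e => [e.1, e.2]).getD (2 * j + 1) 0 = l[j].2 := by
  induction l with
  | nil => exact fun j h => (Nat.not_lt_zero _ h).elim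
  | cons e l ih =>
    intro j h
    obtain - | j := j
    · exact ⟨rfl, rfl⟩
    · exact ih j (Nat.lt_of_succ_lt_succ h)

theorem inputWords_eq {n : ℕ} (k : ℕ) (d : ℤ) (arcs : List (Fin n × Fin n)) :
    inputWords k d arcs = n :: k :: (if d < 0 then 1 else 0) :: d.natAbs :: (natArcs arcs).length ::
      (natArcs arcs).flatMap fun e => [e.1, e.2] := by
  simp [inputWords, natArcs, List.flatMap_map]

theorem mem_inputWords_le {n : ℕ} {k : ℕ} {d : ℤ} {arcs : List (Fin n × Fin n)} {W : ℕ}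
    (hn : n ≤ W) (hk : k ≤ W) (h1 : 1 ≤ W) (hd : d.natAbs ≤ W) (hm : (natArcs arcs).length ≤ W)
    (a : ℕ) : (inputWords k d arcs).getD a 0 ≤ W := by
  have key : ∀ x ∈ inputWords k d arcs, x ≤ W := by
    intro x hx
    rw [inputWords_eq] at hx
    simp only [List.mem_cons, List.mem_flatMap, natArcs, List.mem_map] at hx
    rcases hx with rfl | rfl | rfl | rfl | rfl | ⟨_, ⟨e, -, rfl⟩, hx⟩
    · exact hn
    · exact hk
    · split_ifs <;> omega
    · exact hd
    · exact hm
    · have := e.1.2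
      have := e.2.2
      simp only [List.not_mem_nil, or_false] at hx
      omega
  rw [List.getD_eq_getElem?_getD]
  rcases lt_or_ge a (inputWords k d arcs).length with ha | ha
  · rw [List.getElem?_eq_getElem ha]
    exact key _ (List.getElem_mem ha)
  · rw [List.getElem?_eq_none ha]
    exact Nat.zero_le _

theorem fits_pow {n k m d : ℕ} (hm : m ≤ n) :
    Fits n k m (m + m + n + 5) ((n + k + d + 2) ^ 6) := by
  obtain ⟨N, hN⟩ : ∃ N, N = n + k + d + 2 := ⟨_, rfl⟩
  rw [← hN]
  -- The largest words are sums of addresses, below `11 * N ^ 2`; as `N ≥ 2`, four more powers of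
  -- `N` absorb the constant.
  have h16 : 16 ≤ N ^ 4 := by
    calc 16 = 2 ^ 4 := rfl
      _ ≤ N ^ 4 := Nat.pow_le_pow_left (by omega) 4
  have hW : 16 * (N * N) ≤ N ^ 6 := by
    calc 16 * (N * N) ≤ N ^ 4 * (N * N) := Nat.mul_le_mul_right _ h16
      _ = N ^ 6 := by ring
  have hNN : 2 * N ≤ N * N := Nat.mul_le_mul_right N (by omega)
  have hnk : n * k ≤ (N - 2) * N := Nat.mul_le_mul (by omega) (by omega)
  have hnk' : (N - 2) * N = N * N - 2 * N := Nat.sub_mul _ _ _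
  have hmB : m * (m + m + n + 5 + 8 * n) ≤ N * (11 * N) := Nat.mul_le_mul (by omega) (by omega)
  have hmB' : N * (11 * N) = 11 * (N * N) := by ring
  refine ⟨by omega, by omega, by omega, by omega, by omega⟩

theorem correctOutput_of_layout {n k : ℕ} {G : Digraph (Fin n)} {d : ℤ} {q s : Fin n → ℕ}
    {mem : ℕ → ℕ} (hG : IsPolyforest G) (h : IsLayout k G.Adj (fun _ => min 1 k) q s)
    (hs : ∀ v, s v ≤ k - 1) (hout : ∀ v : Fin n, mem (v + 1) = s v + min 1 k)
    (hmem : mem 0 = 1 - (∑ v, (k - q v) - d.natAbs + if d < 0 then 1 else 0)) :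
    CorrectOutput G k d mem := by
  have hs' : 0 < k → ∀ v, s v < k := fun hk v => by have := hs v; omega
  have hgood := h.isGood hG hs'
  have hopt := hgood.isOptimal
  refine ⟨?_, allocOf k s, hopt, hgood, fun v => ?_⟩
  · rw [hmem, ← h.totalDissatisfaction_eq hG hs']
    -- By optimality the decision problem only needs the total of the computed allocation.
    have hiff : (∃ π : Allocation k (Fin n), (totalDissatisfaction G π : ℤ) ≤ d) ↔
        (totalDissatisfaction G (allocOf k s) : ℤ) ≤ d :=
      ⟨fun ⟨π, hπ⟩ => le_trans (Int.ofNat_le.mpr (hopt π)) hπ, fun h => ⟨_, h⟩⟩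
    simp only [hiff]
    split_ifs <;> omega
  · rw [hout, labelCode_allocOf hs']
    intro hk v
    have := hs v
    omega

theorem solvableInLinearTime_polyforest :
    SolvableInLinearTime fun _ G => IsPolyforest G := by
  refine ⟨mainCmd.compile 0, 300, 6, fun n k d G arcs hG harcs => ?_⟩
  have hleaf := hG.hasLeaves harcs
  have hmem : ∀ e ∈ natArcs arcs, e.1 < n ∧ e.2 < n ∧ e.1 ≠ e.2 := by
    intro e he
    obtain ⟨u, v, huv, rfl⟩ := (mem_natArcs harcs).1 he
    exact ⟨u.2, v.2, fun e => hG.1.ne huv (Fin.ext e)⟩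
  have hm : (natArcs arcs).length ≤ n := by
    have := hleaf.card_le (Finset.range n) fun e he => by
      have := hmem e he
      simp [this.1, this.2.1]
    simpa using this
  have hW := fits_pow (k := k) (d := d.natAbs) hm
  have hpow : n + k + d.natAbs + 2 ≤ (n + k + d.natAbs + 2) ^ 6 := Nat.le_self_pow (by omega) _
  have hle := mem_inputWords_le (arcs := arcs) (k := k) (d := d)
    (W := (n + k + d.natAbs + 2) ^ 6) (by omega) (by omega) (by omega) (by omega) (by omega)
  have heq := inputWords_eq k d arcs
  obtain ⟨s', t, ht, hb, hex, q, l, hlay, hl, hout, h0⟩ := mainCmd_spec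
    (mem₀ := fun a => (inputWords k d arcs).getD a 0) (sgn := if d < 0 then 1 else 0)
    (d := d.natAbs) rfl hW hm hmem hleaf hle (by rw [heq]; rfl) (by rw [heq]; rfl)
    (by rw [heq]; rfl) (by rw [heq]; rfl) (by rw [heq]; rfl)
    (fun a ha => by
      rw [List.getD_eq_default]
      rw [heq]
      simp only [List.length_cons, length_flatMap_pair]
      omega)
    (fun j hj => by
      rw [heq, Nat.add_comm 5, Nat.add_right_comm]
      exact getD_flatMap_pair _ j hj)
    (by split_ifs <;> omega)
  have hrun := hex (mainCmd.compile 0) 0 ⟨[], [], by simp, rfl⟩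
  have hstart : initState (inputWords k d arcs) =
      Store.toState ⟨fun _ => 0, fun a => (inputWords k d arcs).getD a 0⟩ 0 := rfl
  rw [hstart]
  refine ⟨t, ht, ?_, hrun.2, ?_⟩
  · rw [hrun.1, Halted, Cmd.length_compile, Store.toState, Nat.zero_add]
  · rw [hrun.1]
    have hlay' := hlay.of_nat (n := n) fun u v huv => (hmem _ huv).1
    have hadj : (fun u v : Fin n => ((u : ℕ), (v : ℕ)) ∈ natArcs arcs) = G.Adj := by
      funext u v
      rw [mem_natArcs harcs, eq_iff_iff]
      constructor
      · rintro ⟨u', v', h, e⟩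
        simp only [Prod.mk.injEq] at e
        rwa [Fin.ext e.1, Fin.ext e.2]
      · exact fun h => ⟨u, v, h, rfl⟩
    rw [hadj] at hlay'
    refine correctOutput_of_layout hG hlay' (fun v => hl v) (fun v => hout v v.2) ?_
    rw [Fin.sum_univ_eq_sum_range (fun v => k - q v)]
    exact h0

theorem SolvableInLinearTime.mono {𝒢 𝒢' : ∀ n : ℕ, Digraph (Fin n) → Prop}
    (h : SolvableInLinearTime 𝒢) (hle : ∀ n G, 𝒢' n G → 𝒢 n G) : SolvableInLinearTime 𝒢' := by
  obtain ⟨P, C, c, h⟩ := h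
  exact ⟨P, C, c, fun n k d G arcs hG => h n k d G arcs (hle n G hG)⟩

end MinSumDissat

/-- Min-sum dissatisfaction with a common preference graph is solvable in linear time, for any
number of agents, on polytrees and, more generally, on polyforests. -/
theorem theorem4p2 :
    MinSumDissat.SolvableInLinearTime (fun _ G => MinSumDissat.IsPolytree G) ∧
      MinSumDissat.SolvableInLinearTime (fun _ G => MinSumDissat.IsPolyforest G) :=
  ⟨MinSumDissat.solvableInLinearTime_polyforest.mono fun _ _ hG => ⟨hG.1, hG.2.isAcyclic⟩,
    MinSumDissat.solvableInLinearTime_polyforest⟩
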